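/- Let $\Phi$ be a root system of type $C_\ell$, $\ell$ odd, in a Euclidean space $E$, with simple roots $\alpha_1,\dots,\alpha_\ell$ in the usual numbering; up to a similarity of $E\cong\mathbb R^\ell$, $$\Phi=\{\pm(e_i-e_j),\ \pm(e_i+e_j)\ (i<j),\ \pm 2e_k\},\qquad \alpha_i=e_i-e_{i+1}\ (i<\ell),\quad \alpha_\ell=2e_\ell .$$ Let $W$ be the Weyl group and $Z=\{x\in E : (\beta,x)\in\mathbb Z \text{ for all }\beta\in\Phi\}$ the coweight lattice. For a finite set $\Psi\subset E$ and a lattice $L$ in the span of $\Psi$ on which the elements of $\Psi$ take integer values, let $M(\Psi,L;q)$ be the set of classes $x+qL\in L/qL$ with $(\beta,x)\not\equiv 0 \pmod q$ for all $\beta\in\Psi$, and let $\chi^{\mathrm{quasi}}_{\Psi,L}(q)=\#M(\Psi,L;q)$. For $w\in W$ and a positive integer $q$ let $\chi_{\Phi,q}(w)$ be the value at $w$ of the permutation character of $W$ on $M(\Phi,Z;q)$, i.e. the number of points of $M(\Phi,Z;q)$ fixed by $w$. Let $\omega_\ell=w_\ell w_0\in W$, where $w_0$ is the longest element of $W$ and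 $w_\ell$ is the longest element of the subgroup generated by the reflections in $\alpha_1,\dots,\alpha_{\ell-1}$. **Theorem.** For every integer $q\ge 1$: 1. $\chi_{\Phi,q}(1)=\chi^{\mathrm{quasi}}_{\Phi,Z}(q)=\begin{cases}(q-1)(q-3)\cdots(q-(2\ell-1)) & \text{if } q \text{ is odd},\\ (q-2)(q-4)\cdots(q-2(\ell-1))\,(q-\ell) & \text{if } q \text{ is even.}\end{cases}$ 2. $\chi_{\Phi,q}(\omega_\ell)=\begin{cases}0 & \text{if } \gcd(4,q)=1,\\ (q-2)(q-6)\cdots(q-2(\ell-2)) & \text{if } \gcd(4,q)=2,\\ (q-4)(q-8)\cdots(q-2(\ell-1)) & \text{if } \gcd(4,q)=4,\end{cases}$ where the products in the last two cases have $(\ell-1)/2$ factors. 3. For $\beta\in\Phi$ let $\beta^{\omega_\ell}$ be the average of $\beta$ under the cyclic group generated by $\omega_\ell$. The set $\Phi_{\mathrm{re}}=\{\beta^{\omega_\ell} : \beta\in\Phi,\ \beta^{\omega_\ell}\ne 0\}$ is a root system of type $BC_{(\ell-1)/2}$ in its span, and, if $M$ denotes its coweight lattice, $\chi_{\Phi,q}(\omega_\ell)=\chi^{\mathrm{quasi}}_{2\Phi_{\mathrm{re}},M}(q)$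 for all even $q$. -/

import Mathlib

open scoped Pointwise

noncomputable section

namespace RootChar

section General

variable {E : Type*} [NormedAddCommGroup E] [InnerProductSpace ℝ E]

/-- The coweight lattice of `Φ`: the vectors `x` of the Euclidean space spanned by `Φ` such that
`(β, x)` is an integer for all `β ∈ Φ`. -/
def coweightLattice (Φ : Set E) : AddSubgroup E where
  carrier := {x | x ∈ Submodule.span ℝ Φ ∧ ∀ β ∈ Φ, ∃ n : ℤ, inner ℝ β x = (n : ℝ)}
  zero_mem' := ⟨Submodule.zero_mem _, fun β _ => ⟨0, by simp⟩⟩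
  add_mem' := by
    rintro x y ⟨hx, hx'⟩ ⟨hy, hy'⟩
    refine ⟨Submodule.add_mem _ hx hy, fun β hβ => ?_⟩
    obtain ⟨m, hm⟩ := hx' β hβ
    obtain ⟨n, hn⟩ := hy' β hβ
    exact ⟨m + n, by rw [inner_add_right, hm, hn]; push_cast; rfl⟩
  neg_mem' := by
    rintro x ⟨hx, hx'⟩
    refine ⟨Submodule.neg_mem _ hx, fun β hβ => ?_⟩
    obtain ⟨m, hm⟩ := hx' β hβ
    exact ⟨-m, by rw [inner_neg_right, hm]; push_cast; rfl⟩

/-- The quotient `L / qL` of a lattice `L`. -/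
abbrev ModQ (L : AddSubgroup E) (q : ℕ) : Type _ :=
  L ⧸ (nsmulAddMonoidHom (α := L) q).range

/-- The natural projection `π_q : L → L / qL`. -/
def projQ (L : AddSubgroup E) (q : ℕ) (x : L) : ModQ L q :=
  QuotientAddGroup.mk x

/-- `M(Φ, L; q)`: the classes `π_q(x)`, `x ∈ L`, with `(β, x) ≢ 0 (mod q)` for all `β ∈ Φ`.
As `Φ = -Φ` for a root system, it does not matter whether `β` runs over all roots or over the
positive roots. -/
def complementModQ (Φ : Set E) (L : AddSubgroup E) (q : ℕ) : Set (ModQ L q) :=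
  {p | ∃ x : L, projQ L q x = p ∧ ∀ β ∈ Φ, ¬ ∃ n : ℤ, inner ℝ β (x : E) = (q : ℝ) * (n : ℝ)}

/-- The characteristic quasi-polynomial `q ↦ #M(Φ, L; q)` of `Φ` with respect to `L`. -/
def charQuasi (Φ : Set E) (L : AddSubgroup E) (q : ℕ) : ℕ :=
  (complementModQ Φ L q).ncard

/-- The value at `w` of the permutation character `χ_{Φ,q}` on `M(Φ, Z; q)`, where `Z` is the
coweight lattice of `Φ` and `w` acts by `π_q(x) ↦ π_q(w x)`: the number of points of
`M(Φ, Z; q)` that are fixed by `w`. -/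
def equivCharQuasi (Φ : Set E) (q : ℕ) (w : E ≃ₗᵢ[ℝ] E) : ℕ :=
  {p ∈ complementModQ Φ (coweightLattice Φ) q |
    ∃ x y : coweightLattice Φ, (y : E) = w (x : E) ∧
      projQ (coweightLattice Φ) q x = p ∧ projQ (coweightLattice Φ) q y = p}.ncard

/-- The reflection in the hyperplane orthogonal to `α`. -/
def refl (α : E) : E ≃ₗᵢ[ℝ] E :=
  ((Submodule.span ℝ {α})ᗮ).reflection

variable {ι : Type*}

/-- The group generated by the simple reflections `s_i`, `i ∈ K`; for `K = Set.univ` this is the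
Weyl group. -/
def parabolic (α : ι → E) (K : Set ι) : Subgroup (E ≃ₗᵢ[ℝ] E) :=
  Subgroup.closure ((fun i => refl (α i)) '' K)

/-- The length of `w` with respect to the simple reflections `s_i`, `i ∈ K`. -/
def wordLength (α : ι → E) (K : Set ι) (w : E ≃ₗᵢ[ℝ] E) : ℕ :=
  sInf {n | ∃ l : List ι, (∀ i ∈ l, i ∈ K) ∧ l.length = n ∧
    (l.map (fun i => refl (α i))).prod = w}

def IsLongest (α : ι → E) (K : Set ι) (w : E ≃ₗᵢ[ℝ] E) : Prop :=
  w ∈ parabolic α K ∧ ∀ v ∈ parabolic α K, wordLength α K v ≤ wordLength α K w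

/-- The longest element of the group generated by the simple reflections `s_i`, `i ∈ K`. -/
def longest (α : ι → E) (K : Set ι) : E ≃ₗᵢ[ℝ] E :=
  Classical.epsilon (IsLongest α K)

/-- `ω_j = w_j w_0`, where `w_0` is the longest element of the Weyl group, and `w_j` the longest
element of the Weyl group that corresponds to the simple roots other than `α_j`. -/
def omega (α : ι → E) (j : ι) : E ≃ₗᵢ[ℝ] E :=
  longest α {i | i ≠ j} * longest α Set.univ

/-- The average `x^w` of `x` under the cyclic group generated by `w`. -/
def average (w : E ≃ₗᵢ[ℝ] E) (x : E) : E :=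
  (orderOf w : ℝ)⁻¹ • ∑ t ∈ Finset.Icc 1 (orderOf w), (w ^ t) x

/-- The folding of `Φ` by `w`: the nonzero averages `β^w` of the roots `β`. -/
def folding (Φ : Set E) (w : E ≃ₗᵢ[ℝ] E) : Set E :=
  {y | y ≠ 0 ∧ ∃ β ∈ Φ, average w β = y}

end General

/-- The standard basis vector `e_i` of `ℝ^ℓ`. -/
def stdVec {l : ℕ} (i : Fin l) : EuclideanSpace ℝ (Fin l) :=
  EuclideanSpace.single i (1 : ℝ)

/-- The roots `±(e_i - e_j)`, `±(e_i + e_j)` (`i < j`), `±2 e_k` of the standard `C_ℓ`. -/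
def rootsC (l : ℕ) : Set (EuclideanSpace ℝ (Fin l)) :=
  {v | (∃ i j : Fin l, i < j ∧
      (v = stdVec i - stdVec j ∨ v = -(stdVec i - stdVec j) ∨
        v = stdVec i + stdVec j ∨ v = -(stdVec i + stdVec j))) ∨
    ∃ k : Fin l, v = (2 : ℝ) • stdVec k ∨ v = -((2 : ℝ) • stdVec k)}

/-- The simple roots `e_1 - e_2, …, e_{ℓ-1} - e_ℓ, 2 e_ℓ` of the standard `C_ℓ`. -/
def simpleC (l : ℕ) (i : Fin l) : EuclideanSpace ℝ (Fin l) :=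
  if h : (i : ℕ) + 1 < l then stdVec i - stdVec ⟨(i : ℕ) + 1, h⟩ else (2 : ℝ) • stdVec i

/-- The roots `±(e_i - e_j)`, `±(e_i + e_j)` (`i < j`), `±e_k`, `±2 e_k` of the standard
`BC_m`. -/
def rootsBC (m : ℕ) : Set (EuclideanSpace ℝ (Fin m)) :=
  rootsC m ∪ {v | ∃ k : Fin m, v = stdVec k ∨ v = -stdVec k}

section Types

variable {E : Type*} [NormedAddCommGroup E] [InnerProductSpace ℝ E]

/-- `Φ` is a root system of type `C_ℓ` in `E`, with basis `α_1, …, α_ℓ` in the usual numbering: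
a similarity from `ℝ^ℓ` onto `E` takes the standard `C_ℓ` to `Φ` and its simple roots, in order,
to `α_1, …, α_ℓ`. -/
def IsTypeC (l : ℕ) (Φ : Set E) (α : Fin l → E) : Prop :=
  ∃ (c : ℝ) (φ : EuclideanSpace ℝ (Fin l) ≃ₗᵢ[ℝ] E), 0 < c ∧
    Φ = (fun v => c • φ v) '' rootsC l ∧ ∀ i, α i = c • φ (simpleC l i)

/-- `Ψ` is a root system of type `BC_m` in the subspace of `E` that it spans. -/
def IsTypeBC (m : ℕ) (Ψ : Set E) : Prop :=
  ∃ (c : ℝ) (φ : EuclideanSpace ℝ (Fin m) →ₗᵢ[ℝ] E), 0 < c ∧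
    Ψ = (fun v => c • φ v) '' rootsBC m

end Types

end RootChar

end

open RootChar

open scoped Pointwise

namespace RootChar

/-! ### Length, inversions and longest elements for an abstract positive system. -/

section Longest

variable {E : Type*} [NormedAddCommGroup E] [InnerProductSpace ℝ E] {ι : Type*}

/-! Everything is reduced to counting tuples of residues. In an orthonormal basis `b` the roots are
`±c(b i - b j)` and `±c(b i + b j)`, with `i = j` allowed in the sum. Fix an index `r`. The values
of `2c b r` and of `c(b k - b r)`, `k ≠ r`, are free integral coordinates `z` on the coweight
lattice. With `t = z r`, and `u` equal to `z` except for `u r = 0`, the roots take the values `±(u i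
- u j)` and `±(u i + u j + t)`. So M(Φ,Z;q) becomes `regularTuples r q`.

For the identity, fix `t`, which is nonzero. The remaining entries avoid `0`, `-t` and the solutions
of `2u = -t`, and lie in different orbits of `u ↦ -t - u`, all of size two; `ncard_pairwise` gives a
product. For odd `q` it does not depend on `t`. For even `q` it depends on whether `t` is a double,
and the two products combine by a telescoping identity.

For `ω_ℓ`, counting inversions shows that `w_0 = -1` and that `w_ℓ` reverses the basis, so `ω_ℓ`
sends `b k` to `-b k.rev` (`IsSimpleC.omega_apply`). Write `ℓ = 2m + 1` and take `r` in the middle: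
`ω_ℓ` then acts by `z k ↦ -z k.rev`. A fixed regular tuple has a nonzero middle entry whose double
is zero; there is none for odd `q`, and for `q = 2p` the entry is `p`. Since `2v = 0` means `v = 0`
or `v = p`, the two kinds of root conditions merge into conditions on doubles: the lower half
satisfies `4u ≠ 0` and `2u i ≠ ±2u j` (`ncard_fixedTuples`). The classes here have four elements,
and `4u ≠ 0` leaves `q - 2` or `q - 4` residues according to the parity of `p`.

The averages of the `c b k` are `0` and `±h i` with `h i` orthogonal of equal length, so the folding
is of type BC. The `h i` are coordinates on its coweight lattice, and regularity for the doubled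
folding is the same condition on tuples (`charQuasi_signedRootsBC`), which gives the last claim. -/

theorem refl_self (a : E) : refl a a = -a :=
  Submodule.reflection_orthogonalComplement_singleton_eq_neg a

theorem refl_refl (a x : E) : refl a (refl a x) = x :=
  Submodule.reflection_reflection _ x

theorem refl_mul_self (a : E) : refl a * refl a = 1 := by
  ext x
  exact refl_refl a x

theorem refl_apply (a x : E) : refl a x = x - (2 * (inner ℝ a x / ‖a‖ ^ 2)) • a := by
  rw [refl, Submodule.reflection_orthogonal_apply, Submodule.reflection_singleton_apply]
  simp [two_smul, mul_smul]

theorem refl_mem_parabolic (α : ι → E) {K : Set ι} {i : ι} (hi : i ∈ K) :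
    refl (α i) ∈ parabolic α K :=
  Subgroup.subset_closure ⟨i, hi, rfl⟩

theorem parabolic_induction {α : ι → E} {K : Set ι} {p : (E ≃ₗᵢ[ℝ] E) → Prop} (h1 : p 1)
    (hmul : ∀ i ∈ K, ∀ w, p w → p (refl (α i) * w)) {w : E ≃ₗᵢ[ℝ] E}
    (hw : w ∈ parabolic α K) : p w := by
  induction hw using Subgroup.closure_induction_left with
  | one => exact h1
  | mul_left s hs y _ ih =>
    obtain ⟨i, hi, rfl⟩ := hs
    exact hmul i hi y ih
  | inv_mul_cancel s hs y _ ih =>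
    obtain ⟨i, hi, rfl⟩ := hs
    have : (refl (α i))⁻¹ = refl (α i) := inv_eq_of_mul_eq_one_left (refl_mul_self _)
    simp only [this]
    exact hmul i hi y ih

/-- The set of vectors of `P` that `w` takes to `-P`. -/
def inversions (P : Set E) (w : E ≃ₗᵢ[ℝ] E) : Set E := {β | β ∈ P ∧ -(w β) ∈ P}

/-- `P` behaves like the set of positive roots for the reflections in `α i`, `i ∈ K`. -/
structure IsPositiveSystem (α : ι → E) (K : Set ι) (P : Set E) : Prop where
  finite : P.Finite
  neg_notMem : ∀ β ∈ P, -β ∉ P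
  simple_mem : ∀ i ∈ K, α i ∈ P
  refl_mem : ∀ i ∈ K, ∀ β ∈ P, β ≠ α i → refl (α i) β ∈ P
  eq_one : ∀ w ∈ parabolic α K, (∀ i ∈ K, w (α i) ∈ P) → w = 1

variable {α : ι → E} {K : Set ι} {P : Set E}

namespace IsPositiveSystem

theorem refl_mem_or (h : IsPositiveSystem α K P) {i : ι} (hi : i ∈ K) {β : E}
    (hβ : β ∈ P ∨ -β ∈ P) : refl (α i) β ∈ P ∨ -(refl (α i) β) ∈ P := by
  have key : ∀ γ ∈ P, refl (α i) γ ∈ P ∨ -(refl (α i) γ) ∈ P := by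
    intro γ hγ
    by_cases hγi : γ = α i
    · right
      rw [hγi, refl_self, neg_neg]
      exact h.simple_mem i hi
    · exact Or.inl (h.refl_mem i hi γ hγ hγi)
  rcases hβ with hβ | hβ
  · exact key β hβ
  · have := key (-β) hβ
    rw [map_neg, neg_neg] at this
    exact this.symm

theorem apply_mem_or (h : IsPositiveSystem α K P) {w : E ≃ₗᵢ[ℝ] E} (hw : w ∈ parabolic α K)
    {β : E} (hβ : β ∈ P ∨ -β ∈ P) : w β ∈ P ∨ -(w β) ∈ P := by
  exact parabolic_induction (p := fun w => w β ∈ P ∨ -(w β) ∈ P) hβ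
    (fun i hi w ih => h.refl_mem_or hi ih) hw

/-- The reflection in `α i` maps `P \ {α i}` into itself, so it carries the inversions of `w * refl
(α i)` bijectively to those of `w` other than `α i`. -/
theorem ncard_inversions_of_neg (h : IsPositiveSystem α K P) {i : ι} (hi : i ∈ K)
    {w : E ≃ₗᵢ[ℝ] E} (hw : -(w (α i)) ∈ P) :
    (inversions P (w * refl (α i))).ncard + 1 = (inversions P w).ncard := by
  have hfin : (inversions P w).Finite := h.finite.subset fun β hβ => hβ.1
  have hmem : α i ∈ inversions P w := ⟨h.simple_mem i hi, hw⟩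
  rw [← Set.ncard_sdiff_singleton_add_one hmem hfin]
  congr 1
  have : inversions P w \ {α i} = refl (α i) '' inversions P (w * refl (α i)) := by
    ext β
    constructor
    · rintro ⟨⟨h1, h2⟩, h3⟩
      refine ⟨refl (α i) β, ⟨h.refl_mem i hi β h1 h3, ?_⟩, refl_refl _ _⟩
      change -(w (refl (α i) (refl (α i) β))) ∈ P
      rwa [refl_refl]
    · rintro ⟨γ, ⟨h1, h2⟩, rfl⟩
      have h2' : -(w (refl (α i) γ)) ∈ P := h2
      have hne : γ ≠ α i := by
        rintro rfl
        rw [refl_self, map_neg, neg_neg] at h2'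
        exact h.neg_notMem _ h2' hw
      refine ⟨⟨h.refl_mem i hi γ h1 hne, h2'⟩, fun h3 => ?_⟩
      have h4 : refl (α i) γ = α i := h3
      have h5 : γ = -α i := by rw [← refl_refl (α i) γ, h4, refl_self]
      exact h.neg_notMem _ (h.simple_mem i hi) (h5 ▸ h1)
  rw [this, Set.ncard_image_of_injective _ (refl (α i)).injective]

theorem ncard_inversions_of_pos (h : IsPositiveSystem α K P) {i : ι} (hi : i ∈ K)
    {w : E ≃ₗᵢ[ℝ] E} (hw : w (α i) ∈ P) :
    (inversions P (w * refl (α i))).ncard = (inversions P w).ncard + 1 := by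
  have := h.ncard_inversions_of_neg hi (w := w * refl (α i)) (by
    change -(w (refl (α i) (α i))) ∈ P
    rwa [refl_self, map_neg, neg_neg])
  rw [mul_assoc, refl_mul_self, mul_one] at this
  exact this.symm

theorem inversions_one (h : IsPositiveSystem α K P) : inversions P (1 : E ≃ₗᵢ[ℝ] E) = ∅ := by
  ext β
  simp only [inversions, Set.mem_ofPred_eq, Set.mem_empty_iff_false, iff_false, not_and]
  exact fun hβ => h.neg_notMem β hβ

/-- Unless `w = 1`, some simple vector is sent to `-P`, by `eq_one`; multiplying on the right by its
reflection removes exactly one inversion. -/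
theorem exists_word (h : IsPositiveSystem α K P) (n : ℕ) {w : E ≃ₗᵢ[ℝ] E}
    (hw : w ∈ parabolic α K) (hn : (inversions P w).ncard = n) :
    ∃ t : List ι, (∀ i ∈ t, i ∈ K) ∧ t.length = n ∧ (t.map fun i => refl (α i)).prod = w := by
  induction n generalizing w with
  | zero =>
    refine ⟨[], by simp, rfl, ?_⟩
    have hemp : inversions P w = ∅ :=
      (Set.ncard_eq_zero (h.finite.subset fun β hβ => hβ.1)).1 hn
    refine (h.eq_one w hw fun i hi => ?_).symm
    rcases h.apply_mem_or hw (Or.inl (h.simple_mem i hi)) with h1 | h1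
    · exact h1
    · exact absurd (show α i ∈ inversions P w from ⟨h.simple_mem i hi, h1⟩) (by simp [hemp])
  | succ n ih =>
    obtain ⟨i, hi, hwi⟩ : ∃ i ∈ K, -(w (α i)) ∈ P := by
      by_contra! hcon
      have := h.eq_one w hw fun i hi =>
        (h.apply_mem_or hw (Or.inl (h.simple_mem i hi))).resolve_right (hcon i hi)
      rw [this, h.inversions_one, Set.ncard_empty] at hn
      omega
    have h1 := h.ncard_inversions_of_neg hi hwi
    obtain ⟨t, ht, hlen, hprod⟩ :=
      ih (mul_mem hw (refl_mem_parabolic α hi)) (by omega)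
    refine ⟨t ++ [i], ?_, by simp [hlen], ?_⟩
    · intro k hk
      rcases List.mem_append.1 hk with hk | hk
      · exact ht k hk
      · rw [List.mem_singleton.1 hk]
        exact hi
    · rw [List.map_append, List.prod_append, hprod]
      simp [mul_assoc, refl_mul_self]

theorem prod_mem_parabolic (α : ι → E) {K : Set ι} (t : List ι) (ht : ∀ i ∈ t, i ∈ K) :
    (t.map fun i => refl (α i)).prod ∈ parabolic α K := by
  refine list_prod_mem fun x hx => ?_
  obtain ⟨i, hi, rfl⟩ := List.mem_map.1 hx
  exact refl_mem_parabolic α (ht i hi)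

theorem ncard_inversions_le_length (h : IsPositiveSystem α K P) (t : List ι)
    (ht : ∀ i ∈ t, i ∈ K) :
    (inversions P (t.map fun i => refl (α i)).prod).ncard ≤ t.length := by
  induction t using List.reverseRecOn with
  | nil => simp [h.inversions_one]
  | append_singleton t i ih =>
    have ht' : ∀ k ∈ t, k ∈ K := fun k hk => ht k (List.mem_append_left _ hk)
    have hi : i ∈ K := ht i (by simp)
    have h1 := ih ht'
    rw [List.map_append, List.prod_append, List.length_append]
    simp only [List.map_cons, List.map_nil, List.prod_cons, List.prod_nil, mul_one,
      List.length_cons, List.length_nil]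
    rcases h.apply_mem_or (prod_mem_parabolic α t ht') (Or.inl (h.simple_mem i hi)) with h2 | h2
    · have := h.ncard_inversions_of_pos hi h2
      omega
    · have := h.ncard_inversions_of_neg hi h2
      omega

theorem wordLength_eq (h : IsPositiveSystem α K P) {w : E ≃ₗᵢ[ℝ] E}
    (hw : w ∈ parabolic α K) : wordLength α K w = (inversions P w).ncard := by
  refine le_antisymm (Nat.sInf_le (h.exists_word _ hw rfl)) ?_
  -- A word must be known to exist here, because the infimum of the empty set of naturals is `0`.
  refine le_csInf ⟨_, h.exists_word _ hw rfl⟩ ?_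
  rintro n ⟨t, ht, rfl, rfl⟩
  exact h.ncard_inversions_le_length t ht

/-- An element that takes every simple vector to `-P` is the longest one. -/
theorem longest_eq (h : IsPositiveSystem α K P) {w₀ : E ≃ₗᵢ[ℝ] E}
    (h₀ : ∀ w ∈ parabolic α K, (∀ i ∈ K, -(w (α i)) ∈ P) → w = w₀) :
    longest α K = w₀ := by
  have hbound : ∀ w ∈ parabolic α K, wordLength α K w ≤ P.ncard := fun w hw => by
    rw [h.wordLength_eq hw]
    exact Set.ncard_le_ncard (fun β hβ => hβ.1) h.finite
  -- `longest` is an arbitrary choice unless a longest element exists; existence follows since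
  -- lengths are bounded by the size of `P`.
  have hex : ∃ w, IsLongest α K w := by
    let S : Set ℕ := wordLength α K '' (parabolic α K : Set (E ≃ₗᵢ[ℝ] E))
    have hS : S.Nonempty := ⟨_, 1, one_mem _, rfl⟩
    have hb : BddAbove S := ⟨P.ncard, by rintro _ ⟨w, hw, rfl⟩; exact hbound w hw⟩
    obtain ⟨w, hw, hwS⟩ := Nat.sSup_mem hS hb
    exact ⟨w, hw, fun v hv => hwS ▸ le_csSup hb ⟨v, hv, rfl⟩⟩
  have hlong : IsLongest α K (longest α K) := Classical.epsilon_spec hex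
  refine h₀ _ hlong.1 fun i hi => ?_
  rcases h.apply_mem_or hlong.1 (Or.inl (h.simple_mem i hi)) with h1 | h1
  -- If a simple vector stayed in `P`, multiplying by its reflection would give a longer element.
  · have hm := mul_mem hlong.1 (refl_mem_parabolic α hi)
    have h2 := hlong.2 _ hm
    rw [h.wordLength_eq hm, h.wordLength_eq hlong.1, h.ncard_inversions_of_pos hi h1] at h2
    omega
  · exact h1

end IsPositiveSystem

end Longest

/-! ### Counting functions with values in distinct classes. -/

section Counting

/-- The number of functions into `S` whose values lie in different classes, if all classes in `S`
have `k` elements. -/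
theorem ncard_pairwise_fin {X : Type*} [Finite X] (S : Set X) (R : X → X → Prop)
    (hsymm : ∀ u v, R u v → R v u) (htrans : ∀ u v w, R u v → R v w → R u w) (k : ℕ)
    (hk : ∀ u ∈ S, {v ∈ S | R u v}.ncard = k) (n : ℕ) :
    ({f : Fin n → X | (∀ i, f i ∈ S) ∧ ∀ i j, i ≠ j → ¬ R (f i) (f j)}.ncard : ℤ) =
      ∏ i ∈ Finset.range n, ((S.ncard : ℤ) - k * i) := by
  classical
  have := Fintype.ofFinite X
  induction n with
  | zero =>
    have : {f : Fin 0 → X | (∀ i, f i ∈ S) ∧ ∀ i j, i ≠ j → ¬ R (f i) (f j)} = Set.univ := by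
      ext f
      simp
    rw [this]
    simp
  | succ n ih =>
    set A := {f : Fin n → X | (∀ i, f i ∈ S) ∧ ∀ i j, i ≠ j → ¬ R (f i) (f j)} with hA
    set B := {f : Fin (n + 1) → X | (∀ i, f i ∈ S) ∧ ∀ i j, i ≠ j → ¬ R (f i) (f j)} with hB
    have hmaps : ∀ f ∈ B.toFinset, Fin.tail f ∈ A.toFinset := by
      intro f hf
      rw [Set.mem_toFinset] at hf ⊢
      exact ⟨fun i => hf.1 _, fun i j hij => hf.2 _ _ fun h => hij (Fin.succ_injective _ h)⟩
    -- Given the tail `g`, the first value must avoid the classes of the `n` entries of `g`. These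
    -- are disjoint subsets of `S` of size `k`, so the subtraction is not truncated.
    have hfib : ∀ g ∈ A.toFinset,
        (((B.toFinset.filter fun f => Fin.tail f = g).card : ℕ) : ℤ) = S.ncard - k * n := by
      intro g hg
      rw [Set.mem_toFinset] at hg
      let C : Fin n → Finset X := fun i => Finset.univ.filter fun v => v ∈ S ∧ R (g i) v
      have hC : ∀ i, (C i).card = k := fun i => by
        rw [← hk (g i) (hg.1 i), ← Set.ncard_coe_finset]
        congr 1
        ext v
        simp [C]
      have hU : (Finset.univ.biUnion C).card = n * k := by
        rw [Finset.card_biUnion]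
        · simp [hC]
        · intro i _ j _ hij
          change Disjoint (C i) (C j)
          rw [Finset.disjoint_left]
          intro v hv hv'
          simp only [C, Finset.mem_filter, Finset.mem_univ, true_and] at hv hv'
          exact hg.2 i j hij (htrans _ _ _ hv.2 (hsymm _ _ hv'.2))
      have hsub : Finset.univ.biUnion C ⊆ S.toFinset := by
        intro v hv
        simp only [C, Finset.mem_biUnion, Finset.mem_filter, Finset.mem_univ, true_and] at hv
        obtain ⟨i, hv, -⟩ := hv
        simpa using hv
      have hcard : (B.toFinset.filter fun f => Fin.tail f = g).card =
          (S.toFinset \ Finset.univ.biUnion C).card := by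
        refine Finset.card_nbij' (fun f => f 0) (fun x => Fin.cons x g) ?_ ?_ ?_ ?_
        · intro f hf
          simp only [Finset.coe_filter, Set.mem_toFinset, Set.mem_ofPred_eq] at hf
          obtain ⟨hf, rfl⟩ := hf
          simp only [Finset.coe_sdiff, Set.mem_sdiff, Finset.mem_coe, Set.mem_toFinset,
            Finset.mem_biUnion, Finset.mem_univ, true_and, C, Finset.mem_filter, not_exists,
            not_and]
          exact ⟨hf.1 0, fun i _ hR => hf.2 _ _ (Fin.succ_ne_zero i) hR⟩
        · intro x hx
          simp only [Finset.coe_sdiff, Set.mem_sdiff, Finset.mem_coe, Set.mem_toFinset,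
            Finset.mem_biUnion, Finset.mem_univ, true_and, C, Finset.mem_filter, not_exists,
            not_and] at hx
          simp only [Finset.coe_filter, Set.mem_toFinset, Set.mem_ofPred_eq, Fin.tail_cons, and_true]
          refine ⟨fun i => ?_, fun i j hij => ?_⟩
          · refine Fin.cases ?_ (fun i => ?_) i
            · exact hx.1
            · exact hg.1 i
          · induction i using Fin.cases with
            | zero =>
              induction j using Fin.cases with
              | zero => exact absurd rfl hij
              | succ j =>
                simp only [Fin.cons_zero, Fin.cons_succ]
                exact fun h => hx.2 j hx.1 (hsymm _ _ h)
            | succ i =>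
              induction j using Fin.cases with
              | zero =>
                simp only [Fin.cons_zero, Fin.cons_succ]
                exact hx.2 i hx.1
              | succ j =>
                simp only [Fin.cons_succ]
                exact hg.2 i j fun h => hij (h ▸ rfl)
        · intro f hf
          simp only [Finset.coe_filter, Set.mem_toFinset, Set.mem_ofPred_eq] at hf
          obtain ⟨hf, rfl⟩ := hf
          exact Fin.cons_self_tail f
        · intro x _
          rfl
      rw [hcard, Finset.card_sdiff_of_subset hsub, Nat.cast_sub (Finset.card_le_card hsub), hU,
        ← Set.ncard_eq_toFinset_card']
      push_cast
      ring
    rw [Finset.prod_range_succ, ← ih, Set.ncard_eq_toFinset_card', Set.ncard_eq_toFinset_card' A,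
      Finset.card_eq_sum_card_fiberwise hmaps]
    push_cast
    rw [Finset.sum_congr rfl hfib, Finset.sum_const, nsmul_eq_mul]

theorem ncard_pairwise {ι X : Type*} [Fintype ι] [Finite X] (S : Set X) (R : X → X → Prop)
    (hsymm : ∀ u v, R u v → R v u) (htrans : ∀ u v w, R u v → R v w → R u w) (k : ℕ)
    (hk : ∀ u ∈ S, {v ∈ S | R u v}.ncard = k) :
    ({f : ι → X | (∀ i, f i ∈ S) ∧ ∀ i j, i ≠ j → ¬ R (f i) (f j)}.ncard : ℤ) =
      ∏ i ∈ Finset.range (Fintype.card ι), ((S.ncard : ℤ) - k * i) := by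
  rw [← ncard_pairwise_fin S R hsymm htrans k hk]
  let e := Fintype.equivFin ι
  congr 1
  refine Set.ncard_congr (fun f _ => f ∘ e.symm) ?_ ?_ ?_
  · rintro f ⟨h1, h2⟩
    exact ⟨fun i => h1 _, fun i j hij => h2 _ _ fun h => hij (e.symm.injective h)⟩
  · intro f g _ _ h
    funext i
    simpa using congrFun h (e i)
  · rintro g ⟨h1, h2⟩
    refine ⟨g ∘ e, ⟨fun i => h1 _, fun i j hij => h2 _ _ fun h => hij (e.injective h)⟩, ?_⟩
    funext i
    simp

end Counting

/-! ### Integral coordinates and classes modulo `q`. -/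

section Lattice

variable {E : Type*} [NormedAddCommGroup E] [InnerProductSpace ℝ E]

theorem projQ_eq_iff {L : AddSubgroup E} {q : ℕ} {x y : L} :
    projQ L q x = projQ L q y ↔ ∃ z : L, (y : E) = x + (q : ℝ) • (z : E) := by
  rw [projQ, projQ, QuotientAddGroup.eq]
  constructor
  · rintro ⟨z, hz⟩
    refine ⟨z, ?_⟩
    have h := congrArg (Subtype.val) hz
    simp only [nsmulAddMonoidHom_apply, AddSubgroup.coe_nsmul, AddSubgroup.coe_add,
      AddSubgroup.coe_neg] at h
    rw [Nat.cast_smul_eq_nsmul, h]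
    abel
  · rintro ⟨z, hz⟩
    refine ⟨z, Subtype.ext ?_⟩
    simp only [nsmulAddMonoidHom_apply, AddSubgroup.coe_nsmul, AddSubgroup.coe_add,
      AddSubgroup.coe_neg]
    rw [hz, Nat.cast_smul_eq_nsmul]
    abel

/-- The vectors `g k` are integral coordinates on the lattice `L`. -/
structure IsCoordinates {κ : Type*} (L : AddSubgroup E) (g : κ → E) : Prop where
  integral : ∀ x ∈ L, ∀ k, ∃ n : ℤ, inner ℝ (g k) x = n
  eq_zero : ∀ x ∈ L, (∀ k, inner ℝ (g k) x = 0) → x = 0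
  exists_mem : ∀ n : κ → ℤ, ∃ x ∈ L, ∀ k, inner ℝ (g k) x = n k

namespace IsCoordinates

variable {κ : Type*} {L : AddSubgroup E} {g : κ → E}

theorem projQ_eq_iff (h : IsCoordinates L g) {q : ℕ} {x y : L} {m n : κ → ℤ}
    (hm : ∀ k, inner ℝ (g k) (x : E) = m k) (hn : ∀ k, inner ℝ (g k) (y : E) = n k) :
    projQ L q x = projQ L q y ↔ ∀ k, (m k : ZMod q) = n k := by
  rw [RootChar.projQ_eq_iff]
  constructor
  · rintro ⟨z, hz⟩ k
    obtain ⟨t, ht⟩ := h.integral z z.2 k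
    have h1 : n k = m k + q * t := by
      have h2 := hn k
      rw [hz, inner_add_right, inner_smul_right, hm, ht] at h2
      exact_mod_cast h2.symm
    rw [h1]
    simp
  · intro hk
    have : ∀ k, ∃ t : ℤ, n k = m k + q * t := fun k => by
      obtain ⟨t, ht⟩ := (ZMod.intCast_eq_intCast_iff_dvd_sub _ _ _).1 (hk k)
      exact ⟨t, by linarith⟩
    choose t ht using this
    obtain ⟨z, hz, hzt⟩ := h.exists_mem t
    refine ⟨⟨z, hz⟩, ?_⟩
    have h0 : (y : E) - (x + q • z) = 0 := by
      refine h.eq_zero _ (sub_mem y.2 (add_mem x.2 (nsmul_mem hz q))) fun k => ?_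
      rw [← Nat.cast_smul_eq_nsmul ℝ, inner_sub_right, inner_add_right, inner_smul_right, hm, hn,
        hzt, ht]
      push_cast
      ring
    rw [← Nat.cast_smul_eq_nsmul ℝ] at h0
    exact sub_eq_zero.1 h0

/-- Coordinates modulo `q` identify the quotient with `κ → ZMod q`, so a count of classes becomes a
count of tuples once membership has been translated on representatives. -/
theorem ncard_eq (h : IsCoordinates L g) {q : ℕ} (s : Set (ModQ L q)) (s' : Set (κ → ZMod q))
    (hs : ∀ (x : L) (n : κ → ℤ), (∀ k, inner ℝ (g k) (x : E) = n k) →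
      (projQ L q x ∈ s ↔ (fun k => (n k : ZMod q)) ∈ s')) :
    s.ncard = s'.ncard := by
  have hsurj : ∀ p : ModQ L q, ∃ x, projQ L q x = p := fun p => QuotientAddGroup.mk_surjective p
  choose rep hrep using hsurj
  choose n hn using fun x : L => h.integral x x.2
  refine Set.ncard_congr (fun p _ k => (n (rep p) k : ZMod q)) ?_ ?_ ?_
  · intro p hp
    exact (hs _ _ (hn _)).1 ((hrep p).symm ▸ hp)
  · intro p p' _ _ hpp
    rw [← hrep p, ← hrep p', h.projQ_eq_iff (hn _) (hn _)]
    exact congrFun hpp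
  · intro z hz
    choose m hm using fun k => ZMod.intCast_surjective (z k)
    obtain ⟨x, hx, hxm⟩ := h.exists_mem m
    have hz' : z = fun k => (m k : ZMod q) := funext fun k => (hm k).symm
    refine ⟨projQ L q ⟨x, hx⟩, (hs ⟨x, hx⟩ m hxm).2 (hz' ▸ hz), ?_⟩
    funext k
    rw [← hm k]
    exact (h.projQ_eq_iff (hn _) hxm).1 (hrep _) k

end IsCoordinates

/-- Integrality of `Φ` on `L` makes the condition independent of the representative, which removes
the existential quantifier from `complementModQ`. -/
theorem projQ_mem_complementModQ {Φ : Set E} {L : AddSubgroup E} {q : ℕ}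
    (hΦ : ∀ x ∈ L, ∀ β ∈ Φ, ∃ n : ℤ, inner ℝ β x = n) (x : L) :
    projQ L q x ∈ complementModQ Φ L q ↔
      ∀ β ∈ Φ, ∀ n : ℤ, inner ℝ β (x : E) = n → (n : ZMod q) ≠ 0 := by
  have key : ∀ y : L, (∀ β ∈ Φ, ¬ ∃ n : ℤ, inner ℝ β (y : E) = (q : ℝ) * (n : ℝ)) ↔
      ∀ β ∈ Φ, ∀ n : ℤ, inner ℝ β (y : E) = n → (n : ZMod q) ≠ 0 := by
    intro y
    refine forall₂_congr fun β hβ => ?_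
    constructor
    · intro h n hn h0
      obtain ⟨t, rfl⟩ := (ZMod.intCast_zmod_eq_zero_iff_dvd _ _).1 h0
      exact h ⟨t, by rw [hn]; push_cast; rfl⟩
    · rintro h ⟨n, hn⟩
      exact h (q * n) (by rw [hn]; push_cast; rfl) (by simp)
  constructor
  · rintro ⟨y, hy, h⟩ β hβ n hn h0
    obtain ⟨z, hz⟩ := projQ_eq_iff.1 hy
    obtain ⟨t, ht⟩ := hΦ z z.2 β hβ
    refine (key y).1 h β hβ (n - q * t) ?_ (by simp [h0])
    rw [hz, inner_add_right, inner_smul_right, ht] at hn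
    push_cast
    linarith
  · intro h
    exact ⟨x, rfl, (key x).2 h⟩

end Lattice

/-! ### The Weyl group of type `C` and the action of `ω_ℓ` on an orthonormal basis. -/

section TypeC

variable {E : Type*} [NormedAddCommGroup E] [InnerProductSpace ℝ E] {n : ℕ}

/-- The simple roots of type `C` with respect to an orthonormal basis. -/
structure IsSimpleC (c : ℝ) (b : OrthonormalBasis (Fin (n + 1)) ℝ E) (α : Fin (n + 1) → E) :
    Prop where
  pos : 0 < c
  castSucc : ∀ k : Fin n, α k.castSucc = c • (b k.castSucc - b k.succ)
  last : α (Fin.last n) = c • (b (Fin.last n) + b (Fin.last n))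

/-- The roots `c (b i - b j)`, `i < j`. -/
def posRootsA (c : ℝ) (b : OrthonormalBasis (Fin (n + 1)) ℝ E) : Set E :=
  {β | ∃ i j, i < j ∧ β = c • (b i - b j)}

/-- The positive roots of type `C` with respect to an orthonormal basis. -/
def posRootsC (c : ℝ) (b : OrthonormalBasis (Fin (n + 1)) ℝ E) : Set E :=
  posRootsA c b ∪ {β | ∃ i j, β = c • (b i + b j)}

/-- A vector that has positive inner products with all positive roots. -/
noncomputable def heightVec (b : OrthonormalBasis (Fin (n + 1)) ℝ E) : E :=
  ∑ k : Fin (n + 1), ((n : ℝ) + 1 - (k : ℕ)) • b k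

theorem inner_heightVec (b : OrthonormalBasis (Fin (n + 1)) ℝ E) (k : Fin (n + 1)) :
    inner ℝ (heightVec b) (b k) = (n : ℝ) + 1 - (k : ℕ) := by
  simp [heightVec, sum_inner, inner_smul_left, b.inner_eq_ite]

theorem height_pos (k : Fin (n + 1)) : 0 < (n : ℝ) + 1 - (k : ℕ) := by
  have : ((k : ℕ) : ℝ) < (n : ℝ) + 1 := by exact_mod_cast k.2
  linarith

theorem inner_heightVec_pos_of_mem {c : ℝ} (hc : 0 < c)
    {b : OrthonormalBasis (Fin (n + 1)) ℝ E} {β : E} (hβ : β ∈ posRootsC c b) :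
    0 < inner ℝ (heightVec b) β := by
  rcases hβ with ⟨i, j, hij, rfl⟩ | ⟨i, j, rfl⟩
  · rw [inner_smul_right, inner_sub_right, inner_heightVec, inner_heightVec]
    have : ((i : ℕ) : ℝ) < (j : ℕ) := by exact_mod_cast hij
    exact mul_pos hc (by linarith)
  · rw [inner_smul_right, inner_add_right, inner_heightVec, inner_heightVec]
    exact mul_pos hc (add_pos (height_pos i) (height_pos j))

theorem linearIsometryEquiv_ext_basis (b : OrthonormalBasis (Fin (n + 1)) ℝ E)
    {v w : E ≃ₗᵢ[ℝ] E} (h : ∀ k, v (b k) = w (b k)) : v = w := by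
  have : (v.toLinearEquiv : E →ₗ[ℝ] E) = w.toLinearEquiv :=
    b.toBasis.ext fun k => by simpa using h k
  ext x
  exact LinearMap.congr_fun this x

theorem refl_smul {c : ℝ} (hc : c ≠ 0) (v : E) : refl (c • v) = refl v := by
  unfold refl
  simp only [Submodule.span_singleton_smul_eq (IsUnit.mk0 c hc)]

theorem refl_eq_self {a x : E} (h : inner ℝ a x = 0) : refl a x = x := by
  simp [refl_apply, h]

theorem refl_sub_apply (b : OrthonormalBasis (Fin (n + 1)) ℝ E) (i j k : Fin (n + 1)) :
    refl (b i - b j) (b k) = b (Equiv.swap i j k) := by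
  have hij : refl (b i - b j) (b i) = b j := Submodule.reflection_sub (by simp)
  rw [Equiv.swap_apply_def]
  split_ifs with h1 h2
  · rw [h1, hij]
  · rw [h2]
    nth_rewrite 2 [← hij]
    exact refl_refl _ _
  · refine refl_eq_self ?_
    rw [inner_sub_left, b.inner_eq_zero (Ne.symm h1), b.inner_eq_zero (Ne.symm h2), sub_zero]

namespace IsSimpleC

variable {c : ℝ} {b : OrthonormalBasis (Fin (n + 1)) ℝ E} {α : Fin (n + 1) → E}

theorem refl_castSucc (h : IsSimpleC c b α) (k : Fin n) (i : Fin (n + 1)) :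
    refl (α k.castSucc) (b i) = b (Equiv.swap k.castSucc k.succ i) := by
  rw [h.castSucc, refl_smul h.pos.ne', refl_sub_apply]

theorem refl_last_last (h : IsSimpleC c b α) :
    refl (α (Fin.last n)) (b (Fin.last n)) = -b (Fin.last n) := by
  rw [h.last, refl_smul h.pos.ne', ← two_smul ℝ, refl_smul two_ne_zero, refl_self]

theorem refl_last_of_ne (h : IsSimpleC c b α) {i : Fin (n + 1)} (hi : i ≠ Fin.last n) :
    refl (α (Fin.last n)) (b i) = b i := by
  refine refl_eq_self ?_
  rw [h.last, inner_smul_left, inner_add_left, b.inner_eq_zero hi.symm]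
  simp

/-- An adjacent transposition reverses the order of no pair other than the one it exchanges. -/
theorem swap_lt_swap {k : Fin n} {i j : Fin (n + 1)} (hij : i < j)
    (hne : ¬(i = k.castSucc ∧ j = k.succ)) :
    Equiv.swap k.castSucc k.succ i < Equiv.swap k.castSucc k.succ j := by
  simp only [Equiv.swap_apply_def]
  split_ifs <;> simp only [Fin.ext_iff, Fin.lt_def, Fin.val_castSucc, Fin.val_succ] at * <;> omega

theorem refl_castSucc_mem_posRootsA (h : IsSimpleC c b α) (k : Fin n) {β : E}
    (hβ : β ∈ posRootsA c b) (hne : β ≠ α k.castSucc) :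
    refl (α k.castSucc) β ∈ posRootsA c b := by
  obtain ⟨i, j, hij, rfl⟩ := hβ
  refine ⟨_, _, swap_lt_swap (k := k) hij ?_, ?_⟩
  · rintro ⟨rfl, rfl⟩
    exact hne (h.castSucc k).symm
  · rw [map_smul, map_sub, h.refl_castSucc, h.refl_castSucc]

theorem signed_perm (h : IsSimpleC c b α) {w : E ≃ₗᵢ[ℝ] E} (hw : w ∈ parabolic α Set.univ) :
    ∃ (τ : Equiv.Perm (Fin (n + 1))) (ε : Fin (n + 1) → ℝ), ∀ k, (ε k = 1 ∨ ε k = -1) ∧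
      w (b k) = ε k • b (τ k) := by
  refine parabolic_induction (α := α) (K := Set.univ) (p := fun w =>
    ∃ (τ : Equiv.Perm (Fin (n + 1))) (ε : Fin (n + 1) → ℝ), ∀ k, (ε k = 1 ∨ ε k = -1) ∧
      w (b k) = ε k • b (τ k)) ⟨1, 1, fun k => ⟨Or.inl rfl, by simp⟩⟩ ?_ hw
  rintro i - w ⟨τ, ε, hτ⟩
  have hmul : ∀ k, (refl (α i) * w) (b k) = ε k • refl (α i) (b (τ k)) := fun k => by
    change refl (α i) (w (b k)) = _
    rw [(hτ k).2, map_smul]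
  induction i using Fin.lastCases with
  | last =>
    refine ⟨τ, fun k => if τ k = Fin.last n then -ε k else ε k, fun k => ?_⟩
    rw [hmul]
    by_cases hk : τ k = Fin.last n
    · simp only [hk, if_true, h.refl_last_last]
      refine ⟨?_, by simp⟩
      rcases (hτ k).1 with h1 | h1 <;> simp [h1]
    · simp only [hk, if_false, h.refl_last_of_ne hk]
      exact ⟨(hτ k).1, trivial⟩
  | cast i =>
    refine ⟨τ.trans (Equiv.swap i.castSucc i.succ), ε, fun k => ⟨(hτ k).1, ?_⟩⟩
    rw [hmul, h.refl_castSucc]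
    rfl

theorem perm (h : IsSimpleC c b α) {w : E ≃ₗᵢ[ℝ] E}
    (hw : w ∈ parabolic α {i | i ≠ Fin.last n}) :
    ∃ τ : Equiv.Perm (Fin (n + 1)), ∀ k, w (b k) = b (τ k) := by
  refine parabolic_induction (α := α) (K := {i | i ≠ Fin.last n}) (p := fun w =>
    ∃ τ : Equiv.Perm (Fin (n + 1)), ∀ k, w (b k) = b (τ k)) ⟨1, fun k => rfl⟩ ?_ hw
  rintro i hi w ⟨τ, hτ⟩
  induction i using Fin.lastCases with
  | last => exact absurd rfl hi
  | cast i =>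
    refine ⟨τ.trans (Equiv.swap i.castSucc i.succ), fun k => ?_⟩
    change refl (α i.castSucc) (w (b k)) = _
    rw [hτ, h.refl_castSucc]
    rfl

theorem perm_eq_one_of_strictMono {τ : Equiv.Perm (Fin (n + 1))} (hτ : StrictMono τ) :
    ∀ k, τ k = k := by
  have := hτ.range_inj strictMono_id
  exact congrFun (this.1 (by simp))

/-- The heights of the vectors `w (b k)` are strictly decreasing and positive, which forces all
signs to be `+` and the permutation to be increasing, hence trivial. Assuming a signed permutation
rather than a Weyl group element lets this apply to `-w` before `-1` is known to lie in the group.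
-/
theorem eq_one_of_signed_perm (h : IsSimpleC c b α) {w : E ≃ₗᵢ[ℝ] E}
    (hw : ∃ (τ : Equiv.Perm (Fin (n + 1))) (ε : Fin (n + 1) → ℝ), ∀ k, (ε k = 1 ∨ ε k = -1) ∧
      w (b k) = ε k • b (τ k))
    (hpos : ∀ i, w (α i) ∈ posRootsC c b) : w = 1 := by
  obtain ⟨τ, ε, hτ⟩ := hw
  let a : Fin (n + 1) → ℝ := fun k => ε k * ((n : ℝ) + 1 - (τ k : ℕ))
  have ha : ∀ k, inner ℝ (heightVec b) (w (b k)) = a k := fun k => by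
    rw [(hτ k).2, inner_smul_right, inner_heightVec]
  have hanti : StrictAnti a := by
    refine Fin.strictAnti_iff_succ_lt.2 fun k => ?_
    have h1 := inner_heightVec_pos_of_mem h.pos (hpos k.castSucc)
    rw [h.castSucc, map_smul, map_sub, inner_smul_right, inner_sub_right, ha, ha] at h1
    have := (mul_pos_iff_of_pos_left h.pos).1 h1
    linarith
  have hapos : ∀ k, 0 < a k := fun k => by
    have h1 := inner_heightVec_pos_of_mem h.pos (hpos (Fin.last n))
    rw [h.last, map_smul, map_add, inner_smul_right, inner_add_right, ha] at h1
    have h2 := (mul_pos_iff_of_pos_left h.pos).1 h1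
    have h3 := hanti.antitone (Fin.le_last k)
    linarith
  have hε : ∀ k, ε k = 1 := fun k => (hτ k).1.resolve_right fun h1 => by
    have h2 := hapos k
    simp only [a, h1] at h2
    have := height_pos (τ k)
    linarith
  have hmono : StrictMono τ := fun i j hij => by
    have := hanti hij
    simp only [a, hε] at this
    have : ((τ i : ℕ) : ℝ) < (τ j : ℕ) := by linarith
    exact_mod_cast this
  refine linearIsometryEquiv_ext_basis b fun k => ?_
  rw [(hτ k).2, hε, perm_eq_one_of_strictMono hmono, one_smul]
  rfl

theorem finite_posRootsA (c : ℝ) (b : OrthonormalBasis (Fin (n + 1)) ℝ E) :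
    (posRootsA c b).Finite := by
  refine (Set.finite_range fun p : Fin (n + 1) × Fin (n + 1) => c • (b p.1 - b p.2)).subset ?_
  rintro β ⟨i, j, -, rfl⟩
  exact ⟨(i, j), rfl⟩

theorem isPositiveSystem_univ (h : IsSimpleC c b α) :
    IsPositiveSystem α Set.univ (posRootsC c b) where
  finite := by
    refine (finite_posRootsA c b).union ((Set.finite_range
      fun p : Fin (n + 1) × Fin (n + 1) => c • (b p.1 + b p.2)).subset ?_)
    rintro β ⟨i, j, rfl⟩
    exact ⟨(i, j), rfl⟩
  neg_notMem β hβ hβ' := by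
    have h1 := inner_heightVec_pos_of_mem h.pos hβ
    have h2 := inner_heightVec_pos_of_mem h.pos hβ'
    rw [inner_neg_right] at h2
    linarith
  simple_mem i _ := by
    induction i using Fin.lastCases with
    | last => exact Or.inr ⟨_, _, h.last⟩
    | cast i => exact Or.inl ⟨_, _, Fin.castSucc_lt_succ, h.castSucc i⟩
  refl_mem i _ β hβ hne := by
    induction i using Fin.lastCases with
    -- The reflection negates the last basis vector only, so it exchanges `b i - b last` and `b i +
    -- b last` for `i ≠ last`; the case `i = j = last` of a sum is the excluded root itself.
    | last =>
      rcases hβ with ⟨i, j, hij, rfl⟩ | ⟨i, j, rfl⟩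
      · have hi : i ≠ Fin.last n := (hij.trans_le (Fin.le_last j)).ne
        rw [map_smul, map_sub, h.refl_last_of_ne hi]
        by_cases hj : j = Fin.last n
        · rw [hj, h.refl_last_last, sub_neg_eq_add]
          exact Or.inr ⟨_, _, rfl⟩
        · rw [h.refl_last_of_ne hj]
          exact Or.inl ⟨_, _, hij, rfl⟩
      · rw [map_smul, map_add]
        by_cases hi : i = Fin.last n
        · by_cases hj : j = Fin.last n
          · rw [hi, hj, h.last] at hne
            exact absurd rfl hne
          · rw [hi, h.refl_last_last, h.refl_last_of_ne hj, neg_add_eq_sub]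
            exact Or.inl ⟨_, _, lt_of_le_of_ne (Fin.le_last j) hj, rfl⟩
        · rw [h.refl_last_of_ne hi]
          by_cases hj : j = Fin.last n
          · rw [hj, h.refl_last_last, ← sub_eq_add_neg]
            exact Or.inl ⟨_, _, lt_of_le_of_ne (Fin.le_last i) hi, rfl⟩
          · rw [h.refl_last_of_ne hj]
            exact Or.inr ⟨_, _, rfl⟩
    | cast k =>
      rcases hβ with hβ | ⟨i, j, rfl⟩
      · exact Or.inl (h.refl_castSucc_mem_posRootsA k hβ hne)
      · rw [map_smul, map_add, h.refl_castSucc, h.refl_castSucc]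
        exact Or.inr ⟨_, _, rfl⟩
  eq_one w hw hpos := h.eq_one_of_signed_perm (h.signed_perm hw) fun i => hpos i trivial

theorem longest_univ (h : IsSimpleC c b α) :
    longest α Set.univ = LinearIsometryEquiv.neg ℝ := by
  refine h.isPositiveSystem_univ.longest_eq fun w hw hneg => ?_
  obtain ⟨τ, ε, hτ⟩ := h.signed_perm hw
  -- The negative of `w` is again a signed permutation, and it takes all simple roots to positive
  -- ones.
  have h1 : LinearIsometryEquiv.neg ℝ * w = 1 := by
    refine h.eq_one_of_signed_perm ⟨τ, -ε, fun k => ⟨?_, ?_⟩⟩ fun i => hneg i trivial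
    · rcases (hτ k).1 with h2 | h2 <;> simp [h2]
    · change -(w (b k)) = _
      rw [(hτ k).2]
      simp
  ext x
  have h2 : -(w x) = x := congrArg (fun v : E ≃ₗᵢ[ℝ] E => v x) h1
  change w x = -x
  exact neg_eq_iff_eq_neg.1 h2

/-- The isometry that reverses the order of the basis vectors. -/
noncomputable def revIsometry (b : OrthonormalBasis (Fin (n + 1)) ℝ E) : E ≃ₗᵢ[ℝ] E :=
  b.equiv b Fin.revPerm

theorem revIsometry_apply (b : OrthonormalBasis (Fin (n + 1)) ℝ E) (k : Fin (n + 1)) :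
    revIsometry b (b k) = b k.rev := by
  simp [revIsometry]

theorem isPositiveSystem_ne_last (h : IsSimpleC c b α) :
    IsPositiveSystem α {i | i ≠ Fin.last n} (posRootsA c b) where
  finite := finite_posRootsA c b
  neg_notMem β hβ hβ' := h.isPositiveSystem_univ.neg_notMem β (Or.inl hβ) (Or.inl hβ')
  simple_mem i hi := by
    induction i using Fin.lastCases with
    | last => exact absurd rfl hi
    | cast i => exact ⟨_, _, Fin.castSucc_lt_succ, h.castSucc i⟩
  refl_mem i hi β hβ hne := by
    induction i using Fin.lastCases with
    | last => exact absurd rfl hi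
    | cast k => exact h.refl_castSucc_mem_posRootsA k hβ hne
  eq_one w hw hpos := by
    obtain ⟨τ, hτ⟩ := h.perm hw
    have hmono : StrictMono τ := Fin.strictMono_iff_lt_succ.2 fun k => by
      have h1 := inner_heightVec_pos_of_mem h.pos
        (Or.inl (hpos k.castSucc (Fin.castSucc_lt_last k).ne))
      rw [h.castSucc, map_smul, map_sub, hτ, hτ, inner_smul_right, inner_sub_right,
        inner_heightVec, inner_heightVec] at h1
      have := (mul_pos_iff_of_pos_left h.pos).1 h1
      have : ((τ k.castSucc : ℕ) : ℝ) < (τ k.succ : ℕ) := by linarith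
      exact_mod_cast this
    refine linearIsometryEquiv_ext_basis b fun k => ?_
    rw [hτ, perm_eq_one_of_strictMono hmono]
    rfl

theorem longest_ne_last (h : IsSimpleC c b α) :
    longest α {i | i ≠ Fin.last n} = revIsometry b := by
  refine h.isPositiveSystem_ne_last.longest_eq fun w hw hneg => ?_
  obtain ⟨τ, hτ⟩ := h.perm hw
  -- Sending simple roots to negative ones means that `τ` is decreasing; composed with the reversal
  -- it is increasing, hence the identity.
  have hmono : StrictMono (τ.trans Fin.revPerm) := Fin.strictMono_iff_lt_succ.2 fun k => by
    have h1 := inner_heightVec_pos_of_mem h.pos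
      (Or.inl (hneg k.castSucc (Fin.castSucc_lt_last k).ne))
    rw [h.castSucc, map_smul, map_sub, hτ, hτ, inner_neg_right, inner_smul_right,
      inner_sub_right, inner_heightVec, inner_heightVec, ← mul_neg] at h1
    have := (mul_pos_iff_of_pos_left h.pos).1 h1
    have : ((τ k.succ : ℕ) : ℝ) < (τ k.castSucc : ℕ) := by linarith
    exact Fin.rev_lt_rev.2 (by exact_mod_cast this)
  refine linearIsometryEquiv_ext_basis b fun k => ?_
  have h1 : (τ k).rev = k := perm_eq_one_of_strictMono hmono k
  rw [hτ, revIsometry_apply, ← Fin.rev_rev (τ k), h1]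

theorem omega_apply (h : IsSimpleC c b α) (k : Fin (n + 1)) :
    omega α (Fin.last n) (b k) = -b k.rev := by
  rw [omega, h.longest_univ, h.longest_ne_last]
  change revIsometry b (-b k) = _
  rw [map_neg, revIsometry_apply]

end IsSimpleC

theorem IsTypeC.exists_basis {Φ : Set E} {α : Fin (n + 1) → E} (h : IsTypeC (n + 1) Φ α) :
    ∃ (c : ℝ) (b : OrthonormalBasis (Fin (n + 1)) ℝ E), IsSimpleC c b α ∧
      Φ = {β | β ∈ posRootsC c b ∨ -β ∈ posRootsC c b} := by
  obtain ⟨c, φ, hc, hΦ, hα⟩ := h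
  let b := (EuclideanSpace.basisFun (Fin (n + 1)) ℝ).map φ
  have hb : ∀ k, b k = φ (stdVec k) := fun k => by simp [b, stdVec]
  refine ⟨c, b, ⟨hc, fun k => ?_, ?_⟩, ?_⟩
  · rw [hα, simpleC, dif_pos (by simp), hb, hb, map_sub]
    rfl
  · rw [hα, simpleC, dif_neg (by simp), hb, map_smul, two_smul]
  · rw [hΦ]
    ext β
    constructor
    · rintro ⟨v, hv, rfl⟩
      rcases hv with ⟨i, j, hij, rfl | rfl | rfl | rfl⟩ | ⟨k, rfl | rfl⟩
      · exact Or.inl (Or.inl ⟨i, j, hij, by simp [hb]⟩)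
      · exact Or.inr (Or.inl ⟨i, j, hij, by simp [hb, ← smul_neg]⟩)
      · exact Or.inl (Or.inr ⟨i, j, by simp [hb]⟩)
      · exact Or.inr (Or.inr ⟨i, j, by simp [hb, ← smul_neg, add_comm]⟩)
      · exact Or.inl (Or.inr ⟨k, k, by simp [hb, two_smul]⟩)
      · exact Or.inr (Or.inr ⟨k, k, by simp [hb, two_smul]⟩)
    · have key : ∀ β ∈ posRootsC c b, ∃ v ∈ rootsC (n + 1), -v ∈ rootsC (n + 1) ∧ c • φ v = β := by
        rintro β (⟨i, j, hij, rfl⟩ | ⟨i, j, rfl⟩)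
        · exact ⟨stdVec i - stdVec j, Or.inl ⟨i, j, hij, Or.inl rfl⟩,
            Or.inl ⟨i, j, hij, Or.inr (Or.inl rfl)⟩, by simp [hb]⟩
        · rcases lt_trichotomy i j with hij | rfl | hij
          · exact ⟨stdVec i + stdVec j, Or.inl ⟨i, j, hij, by simp⟩,
              Or.inl ⟨i, j, hij, by simp⟩, by simp [hb]⟩
          · exact ⟨(2 : ℝ) • stdVec i, Or.inr ⟨i, by simp⟩, Or.inr ⟨i, by simp⟩,
              by simp [hb, two_smul]⟩
          · exact ⟨stdVec j + stdVec i, Or.inl ⟨j, i, hij, by simp⟩,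
              Or.inl ⟨j, i, hij, by simp⟩, by simp [hb, add_comm]⟩
      rintro (hβ | hβ)
      · obtain ⟨v, hv, -, h1⟩ := key _ hβ
        exact ⟨v, hv, h1⟩
      · obtain ⟨v, -, hv, h1⟩ := key _ hβ
        exact ⟨-v, hv, by simp [h1]⟩

end TypeC

/-! ### Doubling in `ZMod q`. -/

section Residues

/-- The representative of `u` is below `2p` and its double is a multiple of `2p`, which leaves only
`0` and `p`. -/
theorem ZMod_two_mul_eq_zero_iff {p : ℕ} (hp : 0 < p) (u : ZMod (2 * p)) :
    u + u = 0 ↔ u = 0 ∨ u = (p : ℕ) := by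
  have : NeZero (2 * p) := ⟨by omega⟩
  constructor
  · intro h
    have h1 : ((u.val + u.val : ℕ) : ZMod (2 * p)) = 0 := by
      push_cast
      rwa [ZMod.natCast_zmod_val]
    obtain ⟨k, hk⟩ := (ZMod.natCast_eq_zero_iff _ _).1 h1
    have hlt := u.val_lt
    have hk' : u.val = p * k := by linarith
    have hk2 : k < 2 := by
      by_contra hcon
      have : p * 2 ≤ p * k := Nat.mul_le_mul_left p (by omega)
      omega
    interval_cases k
    · left
      exact (ZMod.val_eq_zero u).1 (by omega)
    · right
      rw [← ZMod.natCast_zmod_val u, hk', mul_one]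
  · rintro (rfl | rfl)
    · simp
    · have : ((2 * p : ℕ) : ZMod (2 * p)) = 0 := ZMod.natCast_self _
      push_cast at this
      rw [← two_mul, this]

theorem ZMod_half_ne_zero {p : ℕ} (hp : 0 < p) : ((p : ℕ) : ZMod (2 * p)) ≠ 0 := by
  intro h
  have := Nat.le_of_dvd hp ((ZMod.natCast_eq_zero_iff _ _).1 h)
  omega

theorem ZMod_ncard_double_fiber {p : ℕ} (hp : 0 < p) {t u₀ : ZMod (2 * p)}
    (h₀ : u₀ + u₀ = t) : {u : ZMod (2 * p) | u + u = t}.ncard = 2 := by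
  have : {u : ZMod (2 * p) | u + u = t} = {u₀, u₀ + (p : ℕ)} := by
    ext u
    have h1 : u + u = t ↔ (u - u₀) + (u - u₀) = 0 := by
      rw [← h₀]
      constructor <;> intro h <;> linear_combination h
    simp only [Set.mem_ofPred_eq, Set.mem_insert_iff, Set.mem_singleton_iff]
    rw [h1, ZMod_two_mul_eq_zero_iff hp, sub_eq_zero, sub_eq_iff_eq_add']
  rw [this, Set.ncard_pair]
  exact fun h => ZMod_half_ne_zero hp (by simpa using h)

theorem ZMod_ncard_double_range {p : ℕ} (hp : 0 < p) :
    (Set.range fun u : ZMod (2 * p) => u + u).ncard = p := by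
  classical
  have : NeZero (2 * p) := ⟨by omega⟩
  have h := Finset.card_eq_sum_card_image (fun u : ZMod (2 * p) => u + u) Finset.univ
  rw [Finset.card_univ, ZMod.card, Finset.sum_congr rfl (g := fun _ => 2)] at h
  · rw [Finset.sum_const, smul_eq_mul] at h
    have h2 : (Set.range fun u : ZMod (2 * p) => u + u) =
        (Finset.univ.image fun u : ZMod (2 * p) => u + u : Finset _) := by
      simp
    rw [h2, Set.ncard_coe_finset]
    omega
  · intro t ht
    obtain ⟨u, -, hu⟩ := Finset.mem_image.1 ht
    refine Eq.trans ?_ (ZMod_ncard_double_fiber hp hu)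
    rw [← Set.ncard_coe_finset]
    simp

theorem ZMod_ncard_double_fiber_odd {q : ℕ} (hq : Odd q) (t : ZMod q) :
    {u : ZMod q | u + u = t}.ncard = 1 := by
  obtain ⟨p, rfl⟩ := hq
  have h0 : ((2 * p + 1 : ℕ) : ZMod (2 * p + 1)) = 0 := ZMod.natCast_self _
  push_cast at h0
  rw [Set.ncard_eq_one]
  -- Modulo `2p + 1` the inverse of `2` is `-p`.
  refine ⟨-(p * t), ?_⟩
  ext u
  simp only [Set.mem_ofPred_eq, Set.mem_singleton_iff]
  constructor
  · intro h
    linear_combination (-(p : ZMod (2 * p + 1))) * h + u * h0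
  · rintro rfl
    linear_combination (-t) * h0

end Residues

/-! ### The number of regular tuples, for odd and for even `q`. -/

section Regular

/-- The tuples `z` of residues such that, with `t = z r` and `u` equal to `z` except for `u r = 0`,
the `u i` are distinct and no `u i + u j + t` vanishes. -/
def regularTuples {n : ℕ} (r : Fin (n + 1)) (q : ℕ) : Set (Fin (n + 1) → ZMod q) :=
  {z | (∀ i j, i ≠ j → Function.update z r 0 i ≠ Function.update z r 0 j) ∧
    ∀ i j, Function.update z r 0 i + Function.update z r 0 j + z r ≠ 0}

/-- The residues whose orbit under `u ↦ -t - u` is free and does not contain `0`. -/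
def freeResidues (q : ℕ) (t : ZMod q) : Set (ZMod q) :=
  {u | u ≠ 0 ∧ u + t ≠ 0 ∧ u + u + t ≠ 0}

theorem ncard_freeResidues {q : ℕ} (hq : 0 < q) {t : ZMod q} (ht : t ≠ 0) :
    ((freeResidues q t).ncard : ℤ) = q - 2 - {u : ZMod q | u + u = -t}.ncard := by
  have : NeZero q := ⟨hq.ne'⟩
  have hc : freeResidues q t = ({0, -t} ∪ {u : ZMod q | u + u = -t})ᶜ := by
    ext u
    simp only [freeResidues, Set.mem_ofPred_eq, Set.mem_compl_iff, Set.mem_union,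
      Set.mem_insert_iff, Set.mem_singleton_iff, ne_eq, add_eq_zero_iff_eq_neg]
    tauto
  have hd : Disjoint ({0, -t} : Set (ZMod q)) {u : ZMod q | u + u = -t} := by
    rw [Set.disjoint_left]
    rintro u (rfl | rfl) hu
    · exact ht (by simpa using hu)
    · exact ht (by simpa using hu)
  have h1 := Set.ncard_add_ncard_compl ({0, -t} ∪ {u : ZMod q | u + u = -t})
  rw [← hc, Set.ncard_union_eq hd, Set.ncard_pair (by simpa using ht), Nat.card_zmod] at h1
  omega

/-- Pairing an entry with `r` or with itself puts it in `freeResidues q t`; pairing two other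
entries puts them in different orbits of `u ↦ -t - u`. So `ncard_pairwise` applies with classes of
size two. -/
theorem ncard_regularTuples_fiber {n : ℕ} (r : Fin (n + 1)) {q : ℕ} (hq : 0 < q) {t : ZMod q}
    (ht : t ≠ 0) :
    ({z ∈ regularTuples r q | z r = t}.ncard : ℤ) =
      ∏ i ∈ Finset.range n, (((freeResidues q t).ncard : ℤ) - 2 * i) := by
  have : NeZero q := ⟨hq.ne'⟩
  have h := ncard_pairwise (ι := {j : Fin (n + 1) // j ≠ r}) (freeResidues q t)
    (fun u v => u = v ∨ u + v + t = 0) ?_ ?_ 2 ?_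
  · have hcard : Fintype.card {j : Fin (n + 1) // j ≠ r} = n := by
      simp [Fintype.card_subtype_compl]
    rw [hcard] at h
    push_cast at h
    rw [← h]
    congr 1
    refine Set.ncard_congr (fun z _ j => z j.1) ?_ ?_ ?_
    · rintro z ⟨⟨h1, h2⟩, rfl⟩
      have hu : ∀ j : {j : Fin (n + 1) // j ≠ r}, Function.update z r 0 j.1 = z j.1 := fun j =>
        Function.update_of_ne j.2 _ _
      have hr : Function.update z r 0 r = 0 := Function.update_self _ _ _
      refine ⟨fun j => ⟨?_, ?_, ?_⟩, fun i j hij => ?_⟩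
      · have := h1 j.1 r j.2
        rwa [hu, hr] at this
      · have := h2 j.1 r
        rwa [hu, hr, add_zero] at this
      · have := h2 j.1 j.1
        rwa [hu] at this
      · have h3 := h1 i.1 j.1 fun h => hij (Subtype.ext h)
        have h4 := h2 i.1 j.1
        rw [hu, hu] at h3 h4
        tauto
    · rintro z z' ⟨-, hz⟩ ⟨-, hz'⟩ hzz
      funext j
      by_cases hj : j = r
      · rw [hj, hz, hz']
      · exact congrFun hzz ⟨j, hj⟩
    · rintro f ⟨h1, h2⟩
      let z : Fin (n + 1) → ZMod q := fun j => if hj : j = r then t else f ⟨j, hj⟩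
      have hzr : z r = t := by simp [z]
      have hzj : ∀ j (hj : j ≠ r), Function.update z r 0 j = f ⟨j, hj⟩ := fun j hj => by
        rw [Function.update_of_ne hj]
        simp [z, hj]
      have hr : Function.update z r 0 r = 0 := Function.update_self _ _ _
      refine ⟨z, ⟨⟨fun i j hij => ?_, fun i j => ?_⟩, hzr⟩, ?_⟩
      · by_cases hi : i = r
        · have hj : j ≠ r := fun h => hij (hi.trans h.symm)
          rw [hi, hr, hzj j hj]
          exact (h1 ⟨j, hj⟩).1.symm
        · by_cases hj : j = r
          · rw [hj, hr, hzj i hi]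
            exact (h1 ⟨i, hi⟩).1
          · rw [hzj i hi, hzj j hj]
            exact fun h => h2 ⟨i, hi⟩ ⟨j, hj⟩ (fun h => hij (congrArg Subtype.val h)) (Or.inl h)
      · rw [hzr]
        by_cases hi : i = r
        · by_cases hj : j = r
          · rw [hi, hj, hr]
            simpa using ht
          · rw [hi, hr, hzj j hj, zero_add]
            exact (h1 ⟨j, hj⟩).2.1
        · by_cases hj : j = r
          · rw [hj, hr, hzj i hi, add_zero]
            exact (h1 ⟨i, hi⟩).2.1
          · rw [hzj i hi, hzj j hj]
            by_cases hij : i = j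
            · subst hij
              exact (h1 ⟨i, hi⟩).2.2
            · exact fun h => h2 ⟨i, hi⟩ ⟨j, hj⟩ (fun h => hij (congrArg Subtype.val h)) (Or.inr h)
      · funext j
        simp [z, j.2]
  · rintro u v (h | h)
    · exact Or.inl h.symm
    · exact Or.inr (by rw [← h]; ring)
  · rintro u v w (rfl | h) (rfl | h')
    · exact Or.inl rfl
    · exact Or.inr h'
    · exact Or.inr h
    · exact Or.inl (by linear_combination h - h')
  · rintro u ⟨h1, h2, h3⟩
    -- The involution preserves the free residues, and `2u + t ≠ 0` says that it does not fix `u`.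
    have : {v ∈ freeResidues q t | u = v ∨ u + v + t = 0} = {u, -t - u} := by
      ext v
      simp only [freeResidues, Set.mem_ofPred_eq, Set.mem_insert_iff, Set.mem_singleton_iff]
      constructor
      · rintro ⟨-, h | h⟩
        · exact Or.inl h.symm
        · exact Or.inr (by linear_combination h)
      · rintro (rfl | rfl)
        · exact ⟨⟨h1, h2, h3⟩, Or.inl rfl⟩
        · refine ⟨⟨fun h => h2 (by linear_combination -h), fun h => h1 (by linear_combination -h),
            fun h => h3 (by linear_combination -h)⟩, Or.inr (by ring)⟩
    rw [this, Set.ncard_pair]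
    exact fun h => h3 (by linear_combination h)

theorem ncard_regularTuples {n : ℕ} (r : Fin (n + 1)) {q : ℕ} [NeZero q] :
    ((regularTuples r q).ncard : ℤ) = ∑ t ∈ Finset.univ.erase (0 : ZMod q),
      ∏ i ∈ Finset.range n, (((freeResidues q t).ncard : ℤ) - 2 * i) := by
  classical
  rw [Set.ncard_eq_toFinset_card', Finset.card_eq_sum_card_fiberwise (f := fun z => z r)
    (t := Finset.univ.erase (0 : ZMod q))]
  · rw [Nat.cast_sum]
    refine Finset.sum_congr rfl fun t ht => ?_
    rw [← ncard_regularTuples_fiber r (NeZero.pos q) (Finset.ne_of_mem_erase ht),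
      ← Set.ncard_coe_finset]
    congr 2
    ext z
    simp
  · intro z hz
    have hz' : z ∈ regularTuples r q := by simpa using hz
    -- The condition at `i = j = r` is `z r ≠ 0`, so the fibre over `0` is empty.
    have := hz'.2 r r
    simp only [Function.update_self, zero_add] at this
    simpa using this

/-- For every `t ≠ 0` there are `q - 3` free residues; the number `q - 1` of such `t` supplies the
first factor. -/
theorem ncard_regularTuples_odd {n : ℕ} (r : Fin (n + 1)) {q : ℕ} (hq : Odd q) :
    ((regularTuples r q).ncard : ℤ) = ∏ i ∈ Finset.Icc 1 (n + 1), ((q : ℤ) - (2 * (i : ℤ) - 1)) := by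
  have : NeZero q := ⟨hq.pos.ne'⟩
  rw [ncard_regularTuples, Finset.sum_congr rfl (g := fun _ =>
    ∏ i ∈ Finset.range n, ((q : ℤ) - 3 - 2 * i))]
  · rw [Finset.sum_const, Finset.card_erase_of_mem (Finset.mem_univ _), Finset.card_univ, ZMod.card,
      nsmul_eq_mul, Nat.cast_pred (NeZero.pos q), ← Finset.Ico_add_one_right_eq_Icc,
      Finset.prod_Ico_eq_prod_range, Nat.add_sub_cancel, Finset.prod_range_succ', mul_comm]
    congr 1
    · refine Finset.prod_congr rfl fun i _ => ?_
      push_cast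
      ring
  · intro t ht
    refine Finset.prod_congr rfl fun i _ => ?_
    rw [ncard_freeResidues (NeZero.pos q) (Finset.ne_of_mem_erase ht),
      ZMod_ncard_double_fiber_odd hq]
    push_cast
    ring

theorem ncard_regularTuples_even {n : ℕ} (r : Fin (n + 1)) {q : ℕ} (hq0 : 0 < q) (hq : Even q) :
    ((regularTuples r q).ncard : ℤ) =
      (∏ i ∈ Finset.Icc 1 n, ((q : ℤ) - 2 * (i : ℤ))) * ((q : ℤ) - ((n + 1 : ℕ) : ℤ)) := by
  classical
  obtain ⟨p, rfl⟩ := hq.exists_two_nsmul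
  rw [smul_eq_mul] at *
  have hp : 0 < p := by omega
  have : NeZero (2 * p) := ⟨by omega⟩
  set T : Finset (ZMod (2 * p)) := (Set.range fun u : ZMod (2 * p) => u + u).toFinset with hT
  have hTcard : T.card = p := by
    rw [hT, ← Set.ncard_eq_toFinset_card', ZMod_ncard_double_range hp]
  set A : ℤ := ∏ i ∈ Finset.range n, ((2 * p : ℤ) - 4 - 2 * i) with hA
  set B : ℤ := ∏ i ∈ Finset.range n, ((2 * p : ℤ) - 2 - 2 * i) with hB
  have hT0 : (0 : ZMod (2 * p)) ∈ T := by
    rw [hT, Set.mem_toFinset]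
    exact ⟨0, by simp⟩
  -- Exactly `p` residues are doubles, among them `0`. A nonzero double `t` leaves `q - 4` free
  -- residues and any other `t` leaves `q - 2`.
  have hsum : ((regularTuples r (2 * p)).ncard : ℤ) = (p - 1) * A + p * B := by
    rw [ncard_regularTuples, Finset.sum_congr rfl (g := fun t => if t ∈ T then A else B)]
    · rw [Finset.sum_ite, Finset.sum_const, Finset.sum_const]
      have h1 : (Finset.univ.erase (0 : ZMod (2 * p))).filter (· ∈ T) = T.erase 0 := by
        ext t
        simp
      have h2 : (Finset.univ.erase (0 : ZMod (2 * p))).filter (· ∉ T) = Tᶜ := by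
        ext t
        simp only [Finset.mem_filter, Finset.mem_erase, Finset.mem_univ, and_true,
          Finset.mem_compl, and_iff_right_iff_imp]
        rintro h rfl
        exact h hT0
      rw [h1, h2, Finset.card_erase_of_mem hT0, Finset.card_compl, hTcard, ZMod.card, nsmul_eq_mul,
        nsmul_eq_mul, Nat.cast_pred hp, show 2 * p - p = p by omega]
    · intro t ht
      rw [ncard_freeResidues (NeZero.pos _) (Finset.ne_of_mem_erase ht)]
      split_ifs with htT
      · rw [hT, Set.mem_toFinset] at htT
        obtain ⟨u, rfl⟩ := htT
        rw [ZMod_ncard_double_fiber hp (u₀ := -u) (by simp)]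
        refine Finset.prod_congr rfl fun i _ => ?_
        push_cast
        ring
      · have hemp : {u : ZMod (2 * p) | u + u = -t} = ∅ := by
          rw [Set.eq_empty_iff_forall_notMem]
          intro u hu
          refine htT ?_
          rw [hT, Set.mem_toFinset]
          refine ⟨-u, ?_⟩
          have hu' : u + u = -t := hu
          linear_combination -hu'
        rw [hemp, Set.ncard_empty]
        refine Finset.prod_congr rfl fun i _ => ?_
        push_cast
        ring
  -- Both sides are the product of `2p - 2 - 2i` over `i ≤ n`, with the first or the last factor
  -- split off. Hence `(p - 1)A = (p - 1 - n)B`, and the sum is `(2p - n - 1)B`.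
  have hshift : (2 * p - 2 : ℤ) * A = B * (2 * p - 2 - 2 * n) := by
    rw [hA, hB, ← Finset.prod_range_succ (fun i : ℕ => (2 * p : ℤ) - 2 - 2 * i),
      Finset.prod_range_succ', mul_comm]
    congr 1
    · refine Finset.prod_congr rfl fun i _ => ?_
      push_cast
      ring
    · push_cast
      ring
  have hB' : ∏ i ∈ Finset.Icc 1 n, (((2 * p : ℕ) : ℤ) - 2 * (i : ℤ)) = B := by
    rw [← Finset.Ico_add_one_right_eq_Icc, Finset.prod_Ico_eq_prod_range, Nat.add_sub_cancel]
    refine Finset.prod_congr rfl fun i _ => ?_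
    push_cast
    ring
  rw [hB', hsum]
  push_cast
  linarith

end Regular

/-! ### Coordinates on the coweight lattice of type `C`. -/

section CoweightC

variable {E : Type*} [NormedAddCommGroup E] [InnerProductSpace ℝ E] {n : ℕ}

/-- All roots of type `C` with respect to an orthonormal basis. -/
def signedRootsC (c : ℝ) (b : OrthonormalBasis (Fin (n + 1)) ℝ E) : Set E :=
  {β | β ∈ posRootsC c b ∨ -β ∈ posRootsC c b}

/-- Coordinates on the coweight lattice of type `C`. -/
noncomputable def coordC (c : ℝ) (b : OrthonormalBasis (Fin (n + 1)) ℝ E) (r k : Fin (n + 1)) : E :=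
  if k = r then c • (b r + b r) else c • (b k - b r)

variable {c : ℝ} {b : OrthonormalBasis (Fin (n + 1)) ℝ E}

theorem add_mem_signedRootsC (i j : Fin (n + 1)) : c • (b i + b j) ∈ signedRootsC c b :=
  Or.inl (Or.inr ⟨i, j, rfl⟩)

theorem sub_mem_signedRootsC {i j : Fin (n + 1)} (hij : i ≠ j) :
    c • (b i - b j) ∈ signedRootsC c b := by
  rcases lt_or_gt_of_ne hij with h | h
  · exact Or.inl (Or.inl ⟨i, j, h, rfl⟩)
  · exact Or.inr (Or.inl ⟨j, i, h, by rw [← smul_neg, neg_sub]⟩)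

theorem forall_signedRootsC {p : E → Prop} (hp : ∀ β, p β → p (-β)) :
    (∀ β ∈ signedRootsC c b, p β) ↔
      (∀ i j, i ≠ j → p (c • (b i - b j))) ∧ ∀ i j, p (c • (b i + b j)) := by
  constructor
  · exact fun h => ⟨fun i j hij => h _ (sub_mem_signedRootsC hij),
      fun i j => h _ (add_mem_signedRootsC i j)⟩
  · rintro ⟨h1, h2⟩
    have key : ∀ β ∈ posRootsC c b, p β := by
      rintro β (⟨i, j, hij, rfl⟩ | ⟨i, j, rfl⟩)
      · exact h1 i j hij.ne
      · exact h2 i j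
    rintro β (hβ | hβ)
    · exact key β hβ
    · have := hp _ (key _ hβ)
      rwa [neg_neg] at this

/-- The roots `2c b k` span `E`, so the span condition in `coweightLattice` is automatic. -/
theorem mem_coweightLattice_signedRootsC (hc : c ≠ 0) {x : E} :
    x ∈ coweightLattice (signedRootsC c b) ↔
      ∀ β ∈ signedRootsC c b, ∃ m : ℤ, inner ℝ β x = m := by
  refine ⟨fun h => h.2, fun h => ⟨?_, h⟩⟩
  have hb : ∀ k, b k ∈ Submodule.span ℝ (signedRootsC c b) := fun k => by
    have h1 := Submodule.smul_mem _ (2 * c)⁻¹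
      (Submodule.subset_span (R := ℝ) (add_mem_signedRootsC (c := c) (b := b) k k))
    rwa [smul_smul, ← two_smul ℝ, smul_smul, show (2 * c)⁻¹ * c * 2 = 1 by field_simp,
      one_smul] at h1
  rw [← b.sum_repr x]
  exact Submodule.sum_mem _ fun k _ => Submodule.smul_mem _ _ (hb k)

theorem inner_sub_of_coordC {r : Fin (n + 1)} {x : E} {z : Fin (n + 1) → ℝ}
    (hz : ∀ k, inner ℝ (coordC c b r k) x = z k) (i j : Fin (n + 1)) :
    inner ℝ (c • (b i - b j)) x = Function.update z r 0 i - Function.update z r 0 j := by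
  have key : ∀ i, inner ℝ (c • b i) x - inner ℝ (c • b r) x = Function.update z r 0 i := by
    intro i
    by_cases hi : i = r
    · rw [hi, sub_self, Function.update_self]
    · rw [Function.update_of_ne hi, ← hz i, coordC, if_neg hi, smul_sub, inner_sub_left]
  rw [← key, ← key, smul_sub, inner_sub_left]
  ring

theorem inner_add_of_coordC {r : Fin (n + 1)} {x : E} {z : Fin (n + 1) → ℝ}
    (hz : ∀ k, inner ℝ (coordC c b r k) x = z k) (i j : Fin (n + 1)) :
    inner ℝ (c • (b i + b j)) x =
      Function.update z r 0 i + Function.update z r 0 j + z r := by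
  have h1 := inner_sub_of_coordC hz i r
  have h2 := inner_sub_of_coordC hz j r
  have h3 := hz r
  rw [coordC, if_pos rfl, smul_add, inner_add_left] at h3
  rw [Function.update_self, smul_sub, inner_sub_left] at h1 h2
  rw [smul_add, inner_add_left]
  linarith

theorem cast_update {A : Type*} [AddGroupWithOne A] (m : Fin (n + 1) → ℤ) (r i : Fin (n + 1)) :
    ((Function.update m r 0 i : ℤ) : A) = Function.update (fun k => (m k : A)) r 0 i := by
  by_cases hi : i = r
  · simp [hi]
  · simp [Function.update_of_ne hi]

theorem isCoordinates_coordC (hc : c ≠ 0) (r : Fin (n + 1)) :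
    IsCoordinates (coweightLattice (signedRootsC c b)) (coordC c b r) where
  integral x hx k := by
    rw [coordC]
    split_ifs with hk
    · exact hx.2 _ (add_mem_signedRootsC r r)
    · exact hx.2 _ (sub_mem_signedRootsC hk)
  eq_zero x hx h := by
    have h0 : ∀ k, inner ℝ (b k) x = 0 := fun k => by
      have := inner_add_of_coordC (z := 0) h k k
      rw [inner_smul_left, inner_add_left] at this
      simpa [hc] using this
    rw [← b.sum_repr x]
    simp [b.repr_apply_apply, h0]
  exists_mem m := by
    -- The value of `c b r` is half of `m r`, that of `2c b r`; each other `c b k` exceeds it by `m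
    -- k`.
    let x : E := ∑ k, ((Function.update (fun k => (m k : ℝ)) r 0 k + m r / 2) / c) • b k
    have hx : ∀ k, inner ℝ (b k) x =
        (Function.update (fun k => (m k : ℝ)) r 0 k + m r / 2) / c := fun k => by
      simp [x, inner_sum, inner_smul_right, b.inner_eq_ite]
    refine ⟨x, (mem_coweightLattice_signedRootsC hc).2 ?_, fun k => ?_⟩
    · refine (forall_signedRootsC (p := fun β => ∃ m : ℤ, inner ℝ β x = m) ?_).2 ⟨?_, ?_⟩
      · rintro β ⟨m, hm⟩
        exact ⟨-m, by simp [hm]⟩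
      · intro i j _
        refine ⟨Function.update m r 0 i - Function.update m r 0 j, ?_⟩
        rw [inner_smul_left, inner_sub_left, hx, hx]
        push_cast [cast_update]
        simp only [conj_trivial]
        field_simp
        ring
      · intro i j
        refine ⟨Function.update m r 0 i + Function.update m r 0 j + m r, ?_⟩
        rw [inner_smul_left, inner_add_left, hx, hx]
        push_cast [cast_update]
        simp only [conj_trivial]
        field_simp
        ring
    · rw [coordC]
      split_ifs with hk
      · rw [inner_smul_left, inner_add_left, hx, hk, Function.update_self]
        simp only [conj_trivial]
        field_simp
        ring
      · rw [inner_smul_left, inner_sub_left, hx, hx, Function.update_self,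
          Function.update_of_ne hk]
        simp only [conj_trivial]
        field_simp
        ring

theorem projQ_mem_complementModQ_signedRootsC {r : Fin (n + 1)} {q : ℕ}
    (x : coweightLattice (signedRootsC c b)) (m : Fin (n + 1) → ℤ)
    (hm : ∀ k, inner ℝ (coordC c b r k) (x : E) = m k) :
    projQ _ q x ∈ complementModQ (signedRootsC c b) (coweightLattice (signedRootsC c b)) q ↔
      (fun k => (m k : ZMod q)) ∈ regularTuples r q := by
  rw [projQ_mem_complementModQ (L := coweightLattice (signedRootsC c b)) (fun x hx => hx.2),
    forall_signedRootsC]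
  · refine and_congr (forall₃_congr fun i j _ => ?_) (forall₂_congr fun i j => ?_)
    · have h1 := inner_sub_of_coordC hm i j
      rw [← cast_update, ← cast_update, ← Int.cast_sub] at h1
      rw [h1, ← cast_update, ← cast_update, ← sub_ne_zero, ← Int.cast_sub]
      exact ⟨fun h => h _ rfl, fun h k hk => by rwa [← Int.cast_injective hk]⟩
    · have h1 := inner_add_of_coordC hm i j
      rw [← cast_update, ← cast_update, ← Int.cast_add, ← Int.cast_add] at h1
      rw [h1, ← cast_update, ← cast_update, ← Int.cast_add, ← Int.cast_add]
      exact ⟨fun h => h _ rfl, fun h k hk => by rwa [← Int.cast_injective hk]⟩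
  · intro β hβ k hk h0
    refine hβ (-k) ?_ (by simp [h0])
    rw [inner_neg_left] at hk
    push_cast
    linarith

theorem charQuasi_signedRootsC (hc : c ≠ 0) (r : Fin (n + 1)) (q : ℕ) :
    charQuasi (signedRootsC c b) (coweightLattice (signedRootsC c b)) q =
      (regularTuples r q).ncard :=
  (isCoordinates_coordC hc r).ncard_eq _ _ projQ_mem_complementModQ_signedRootsC

theorem equivCharQuasi_one (Φ : Set E) (q : ℕ) :
    equivCharQuasi Φ q 1 = charQuasi Φ (coweightLattice Φ) q := by
  unfold equivCharQuasi charQuasi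
  congr 1
  ext p
  refine ⟨fun h => h.1, fun h => ⟨h, ?_⟩⟩
  obtain ⟨x, hx, -⟩ := h
  exact ⟨x, x, rfl, hx, hx⟩

end CoweightC

/-! ### Counting tuples of residues through their doubles. -/

section FoldTuples

/-- The tuples of residues whose doubles are not opposite to themselves and pairwise neither equal
nor opposite. -/
def foldTuples (m q : ℕ) : Set (Fin m → ZMod q) :=
  {z | (∀ i, z i ∈ {u : ZMod q | u + u + (u + u) ≠ 0}) ∧
    ∀ i j, i ≠ j → ¬ (z i + z i = z j + z j ∨ z i + z i = -(z j + z j))}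

theorem ncard_foldTuples {p : ℕ} (hp : 0 < p) (m : ℕ) :
    ((foldTuples m (2 * p)).ncard : ℤ) = ∏ i ∈ Finset.range m,
      (({u : ZMod (2 * p) | u + u + (u + u) ≠ 0}.ncard : ℤ) - 4 * i) := by
  have : NeZero (2 * p) := ⟨by omega⟩
  have h := ncard_pairwise (ι := Fin m) {u : ZMod (2 * p) | u + u + (u + u) ≠ 0}
    (fun u v => u + u = v + v ∨ u + u = -(v + v)) ?_ ?_ 4 ?_
  · rw [Fintype.card_fin] at h
    exact h
  · rintro u v (h | h)
    · exact Or.inl h.symm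
    · exact Or.inr (by rw [h, neg_neg])
  · rintro u v w (h | h) (h' | h')
    · exact Or.inl (h.trans h')
    · exact Or.inr (h.trans h')
    · exact Or.inr (by rw [h, h'])
    · exact Or.inl (by rw [h, h', neg_neg])
  · intro u hu
    have hu' : u + u + (u + u) ≠ 0 := hu
    -- A class is the union of two fibres of doubling, each with two elements; they are disjoint
    -- because `4u ≠ 0`.
    have hset : {v ∈ {u : ZMod (2 * p) | u + u + (u + u) ≠ 0} | u + u = v + v ∨ u + u = -(v + v)} =
        {v | v + v = u + u} ∪ {v | v + v = -(u + u)} := by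
      ext v
      simp only [Set.mem_ofPred_eq, Set.mem_union]
      constructor
      · rintro ⟨-, h | h⟩
        · exact Or.inl h.symm
        · exact Or.inr (by rw [h, neg_neg])
      · rintro (h | h)
        · exact ⟨by rwa [h], Or.inl h.symm⟩
        · refine ⟨?_, Or.inr (by rw [h, neg_neg])⟩
          rw [h, ← neg_add]
          exact neg_ne_zero.2 hu'
    have hd : Disjoint {v | v + v = u + u} {v | v + v = -(u + u)} := by
      rw [Set.disjoint_left]
      intro v h1 h2
      have h1' : v + v = u + u := h1
      have h2' : v + v = -(u + u) := h2
      exact hu' (by linear_combination h2' - h1')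
    rw [hset, Set.ncard_union_eq hd, ZMod_ncard_double_fiber hp rfl,
      ZMod_ncard_double_fiber hp (u₀ := -u) (by ring)]

theorem ZMod_quadruple_eq_zero {p : ℕ} (hp : 0 < p) :
    {u : ZMod (2 * p) | u + u + (u + u) ≠ 0} =
      ({u : ZMod (2 * p) | u + u = 0} ∪ {u : ZMod (2 * p) | u + u = (p : ℕ)})ᶜ := by
  ext u
  simp only [Set.mem_ofPred_eq, Set.mem_compl_iff, Set.mem_union, ne_eq,
    ZMod_two_mul_eq_zero_iff hp (u + u)]

theorem ncard_foldTuples_odd {p : ℕ} (hp : Odd p) (m : ℕ) :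
    ((foldTuples m (2 * p)).ncard : ℤ) =
      ∏ i ∈ Finset.Icc 1 m, (((2 * p : ℕ) : ℤ) - 2 * (2 * (i : ℤ) - 1)) := by
  have hp0 : 0 < p := hp.pos
  have : NeZero (2 * p) := ⟨by omega⟩
  have hemp : {u : ZMod (2 * p) | u + u = (p : ℕ)} = ∅ := by
    rw [Set.eq_empty_iff_forall_notMem]
    intro u hu
    -- Reduction modulo `2` kills the double but not the odd `p`, so only the two solutions of `2u =
    -- 0` are removed.
    have h1 := congrArg (ZMod.castHom (dvd_mul_right 2 p) (ZMod 2)) hu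
    rw [map_add, map_natCast, CharTwo.add_self_eq_zero, eq_comm, ZMod.natCast_eq_zero_iff] at h1
    exact Nat.not_even_iff_odd.2 hp (even_iff_two_dvd.2 h1)
  have hcard := Set.ncard_add_ncard_compl {u : ZMod (2 * p) | u + u = 0}
  rw [ZMod_ncard_double_fiber hp0 (u₀ := 0) (by simp), Nat.card_zmod] at hcard
  rw [ncard_foldTuples hp0, ZMod_quadruple_eq_zero hp0, hemp, Set.union_empty,
    ← Finset.Ico_add_one_right_eq_Icc, Finset.prod_Ico_eq_prod_range, Nat.add_sub_cancel]
  refine Finset.prod_congr rfl fun i _ => ?_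
  push_cast
  omega

theorem ncard_foldTuples_even {p : ℕ} (hp0 : 0 < p) (hp : Even p) (m : ℕ) :
    ((foldTuples m (2 * p)).ncard : ℤ) =
      ∏ i ∈ Finset.Icc 1 m, (((2 * p : ℕ) : ℤ) - 4 * (i : ℤ)) := by
  have : NeZero (2 * p) := ⟨by omega⟩
  obtain ⟨s, hs⟩ := hp
  have hd : Disjoint {u : ZMod (2 * p) | u + u = 0} {u | u + u = (p : ℕ)} := by
    rw [Set.disjoint_left]
    intro v h1 h2
    have h1' : v + v = 0 := h1
    have h2' : v + v = (p : ℕ) := h2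
    exact ZMod_half_ne_zero hp0 (h2'.symm.trans h1')
  have hcard := Set.ncard_add_ncard_compl
    ({u : ZMod (2 * p) | u + u = 0} ∪ {u | u + u = (p : ℕ)})
  -- For `p = 2s` the equation `2u = p` is solved by `s`, so four residues are removed.
  rw [Set.ncard_union_eq hd, ZMod_ncard_double_fiber hp0 (u₀ := 0) (by simp),
    ZMod_ncard_double_fiber hp0 (u₀ := (s : ℕ)) (by rw [← Nat.cast_add, ← hs]),
    Nat.card_zmod] at hcard
  rw [ncard_foldTuples hp0, ZMod_quadruple_eq_zero hp0,
    ← Finset.Ico_add_one_right_eq_Icc, Finset.prod_Ico_eq_prod_range, Nat.add_sub_cancel]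
  refine Finset.prod_congr rfl fun i _ => ?_
  push_cast
  omega

end FoldTuples

/-! ### Regular tuples fixed by the twisted reversal. -/

section FixedTuples

/-- The middle index. -/
def midIndex (m : ℕ) : Fin (2 * m + 1) := ⟨m, by omega⟩

/-- The indices before the middle one. -/
def lowIndex {m : ℕ} (i : Fin m) : Fin (2 * m + 1) := ⟨i, by omega⟩

variable {m : ℕ}

theorem rev_midIndex : (midIndex m).rev = midIndex m := by
  ext
  simp only [midIndex, Fin.val_rev]
  omega

theorem lowIndex_injective : Function.Injective (lowIndex (m := m)) := fun i j h => by
  simpa [lowIndex, Fin.ext_iff] using h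

theorem lowIndex_ne_midIndex (i : Fin m) : lowIndex i ≠ midIndex m := fun h => by
  have := congrArg Fin.val h
  simp only [lowIndex, midIndex] at this
  omega

theorem rev_lowIndex_ne_midIndex (i : Fin m) : (lowIndex i).rev ≠ midIndex m := fun h =>
  lowIndex_ne_midIndex i (by rw [← Fin.rev_rev (lowIndex i), h, rev_midIndex])

theorem lowIndex_ne_rev (i j : Fin m) : lowIndex i ≠ (lowIndex j).rev := fun h => by
  have := congrArg Fin.val h
  simp only [lowIndex, Fin.val_rev] at this
  omega

theorem index_cases (k : Fin (2 * m + 1)) :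
    k = midIndex m ∨ ∃ i : Fin m, k = lowIndex i ∨ k = (lowIndex i).rev := by
  rcases lt_trichotomy (k : ℕ) m with h | h | h
  · exact Or.inr ⟨⟨k, h⟩, Or.inl rfl⟩
  · exact Or.inl (Fin.ext h)
  · refine Or.inr ⟨⟨2 * m - k, by omega⟩, Or.inr (Fin.ext ?_)⟩
    simp only [lowIndex, Fin.val_rev]
    omega

/-- The regular tuples that are invariant under `z ↦ (k ↦ -z k.rev)`. -/
def fixedTuples (m q : ℕ) : Set (Fin (2 * m + 1) → ZMod q) :=
  {z ∈ regularTuples (midIndex m) q | ∀ k, z k + z k.rev = 0}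

theorem apply_midIndex_ne_zero {q : ℕ} {z : Fin (2 * m + 1) → ZMod q}
    (hz : z ∈ fixedTuples m q) : z (midIndex m) ≠ 0 := by
  have := hz.1.2 (midIndex m) (midIndex m)
  simpa using this

theorem fixedTuples_odd {q : ℕ} (hq : Odd q) : fixedTuples m q = ∅ := by
  rw [Set.eq_empty_iff_forall_notMem]
  intro z hz
  have h1 := hz.2 (midIndex m)
  rw [rev_midIndex] at h1
  obtain ⟨a, ha⟩ := Set.ncard_eq_one.1 (ZMod_ncard_double_fiber_odd hq 0)
  have h2 : z (midIndex m) ∈ ({a} : Set (ZMod q)) := ha ▸ h1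
  have h3 : (0 : ZMod q) ∈ ({a} : Set (ZMod q)) := ha ▸ (add_zero 0)
  exact apply_midIndex_ne_zero hz (h2.trans h3.symm)

theorem apply_midIndex_eq {p : ℕ} (hp : 0 < p) {z : Fin (2 * m + 1) → ZMod (2 * p)}
    (hz : z ∈ fixedTuples m (2 * p)) : z (midIndex m) = (p : ℕ) := by
  have h1 := hz.2 (midIndex m)
  rw [rev_midIndex] at h1
  exact ((ZMod_two_mul_eq_zero_iff hp _).1 h1).resolve_left (apply_midIndex_ne_zero hz)

/-- The antisymmetric tuple with given lower half and given middle entry. -/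
def unfoldTuple {A : Type*} [Neg A] (t : A) (f : Fin m → A) (k : Fin (2 * m + 1)) : A :=
  if h : (k : ℕ) < m then f ⟨k, h⟩ else
    if h' : m < (k : ℕ) then -f ⟨2 * m - k, by omega⟩ else t

theorem unfoldTuple_mid {A : Type*} [Neg A] (t : A) (f : Fin m → A) :
    unfoldTuple t f (midIndex m) = t := by
  simp [unfoldTuple, midIndex]

theorem unfoldTuple_low {A : Type*} [Neg A] (t : A) (f : Fin m → A) (i : Fin m) :
    unfoldTuple t f (lowIndex i) = f i := by
  simp [unfoldTuple, lowIndex]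

theorem unfoldTuple_rev_low {A : Type*} [Neg A] (t : A) (f : Fin m → A) (i : Fin m) :
    unfoldTuple t f (lowIndex i).rev = -f i := by
  have h1 : ¬ ((lowIndex i).rev : ℕ) < m := by
    simp only [lowIndex, Fin.val_rev]
    omega
  have h2 : m < ((lowIndex i).rev : ℕ) := by
    simp only [lowIndex, Fin.val_rev]
    omega
  rw [unfoldTuple, dif_neg h1, dif_pos h2]
  congr 2
  ext
  simp only [lowIndex, Fin.val_rev]
  omega

/-- A fixed tuple is determined by its lower half, since its middle entry is `p`. The root
conditions `v ≠ 0` and `v + p ≠ 0` together say `2v ≠ 0`, for `v` a difference or a sum of two lower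
entries. -/
theorem ncard_fixedTuples {p : ℕ} (hp : 0 < p) :
    (fixedTuples m (2 * p)).ncard = (foldTuples m (2 * p)).ncard := by
  have hpp : ((p : ℕ) : ZMod (2 * p)) + (p : ℕ) = 0 := (ZMod_two_mul_eq_zero_iff hp _).2 (Or.inr rfl)
  refine Set.ncard_congr (fun z _ i => z (lowIndex i)) ?_ ?_ ?_
  · intro z hz
    have ht := apply_midIndex_eq hp hz
    obtain ⟨⟨h1, h2⟩, h3⟩ := hz
    have hl : ∀ i : Fin m, Function.update z (midIndex m) 0 (lowIndex i) = z (lowIndex i) :=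
      fun i => Function.update_of_ne (lowIndex_ne_midIndex i) _ _
    have hr : ∀ i : Fin m,
        Function.update z (midIndex m) 0 (lowIndex i).rev = -z (lowIndex i) := fun i => by
      rw [Function.update_of_ne (rev_lowIndex_ne_midIndex i)]
      linear_combination h3 (lowIndex i)
    refine ⟨fun i h => ?_, fun i j hij => ?_⟩
    · rcases (ZMod_two_mul_eq_zero_iff hp _).1 h with h | h
      · have := h1 _ _ (lowIndex_ne_rev i i)
        rw [hl, hr] at this
        exact this (by linear_combination h)
      · have := h2 (lowIndex i) (lowIndex i)
        rw [hl, ht] at this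
        exact this (by linear_combination h + hpp)
    · have hne : lowIndex i ≠ lowIndex j := fun h => hij (lowIndex_injective h)
      rintro (h | h)
      · have h' : (z (lowIndex i) - z (lowIndex j)) + (z (lowIndex i) - z (lowIndex j)) = 0 := by
          linear_combination h
        -- A difference `0` contradicts distinctness; a difference `p` contradicts the sum condition
        -- at `i` and the mirror of `j`, as `t = p`.
        rcases (ZMod_two_mul_eq_zero_iff hp _).1 h' with h' | h'
        · have := h1 _ _ hne
          rw [hl, hl] at this
          exact this (by linear_combination h')
        · have := h2 (lowIndex i) (lowIndex j).rev
          rw [hl, hr, ht] at this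
          exact this (by linear_combination h' + hpp)
      · have h' : (z (lowIndex i) + z (lowIndex j)) + (z (lowIndex i) + z (lowIndex j)) = 0 := by
          linear_combination h
        rcases (ZMod_two_mul_eq_zero_iff hp _).1 h' with h' | h'
        · have := h1 _ _ (lowIndex_ne_rev i j)
          rw [hl, hr] at this
          exact this (by linear_combination h')
        · have := h2 (lowIndex i) (lowIndex j)
          rw [hl, hl, ht] at this
          exact this (by linear_combination h' + hpp)
  · intro z z' hz hz' hzz
    have hlow : ∀ i : Fin m, z (lowIndex i) = z' (lowIndex i) := congrFun hzz
    funext k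
    rcases index_cases k with rfl | ⟨i, rfl | rfl⟩
    · rw [apply_midIndex_eq hp hz, apply_midIndex_eq hp hz']
    · exact hlow i
    · have h1 := hz.2 (lowIndex i)
      have h2 := hz'.2 (lowIndex i)
      linear_combination h1 - h2 - hlow i
  · rintro f ⟨h1, h2⟩
    let z : Fin (2 * m + 1) → ZMod (2 * p) := unfoldTuple ((p : ℕ) : ZMod (2 * p)) f
    have hmid : z (midIndex m) = (p : ℕ) := unfoldTuple_mid _ f
    have hlow : ∀ i, z (lowIndex i) = f i := unfoldTuple_low _ f
    have hrev : ∀ i, z (lowIndex i).rev = -f i := unfoldTuple_rev_low _ f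
    set u : Fin (2 * m + 1) → ZMod (2 * p) := Function.update z (midIndex m) 0 with hu
    have umid : u (midIndex m) = 0 := Function.update_self _ _ _
    have ulow : ∀ i, u (lowIndex i) = f i := fun i => by
      rw [hu, Function.update_of_ne (lowIndex_ne_midIndex i), hlow]
    have urev : ∀ i, u (lowIndex i).rev = -f i := fun i => by
      rw [hu, Function.update_of_ne (rev_lowIndex_ne_midIndex i), hrev]
    have hanti : ∀ k, u k.rev = -u k := fun k => by
      rcases index_cases k with rfl | ⟨i, rfl | rfl⟩
      · rw [rev_midIndex, umid, neg_zero]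
      · rw [urev, ulow]
      · rw [Fin.rev_rev, urev, ulow, neg_neg]
    have hz3 : ∀ k, z k + z k.rev = 0 := fun k => by
      rcases index_cases k with rfl | ⟨i, rfl | rfl⟩
      · rw [rev_midIndex, hmid, hpp]
      · rw [hlow, hrev, add_neg_cancel]
      · rw [Fin.rev_rev, hlow, hrev, neg_add_cancel]
    have h4 : ∀ i, f i + f i + (f i + f i) ≠ 0 := h1
    -- Even the doubles of all entries of `u` are distinct, and both kinds of regularity conditions
    -- follow from this.
    have key : ∀ k l, k ≠ l → u k + u k ≠ u l + u l := by
      intro k l hkl h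
      rcases index_cases k with rfl | ⟨i, rfl | rfl⟩ <;>
        rcases index_cases l with rfl | ⟨j, rfl | rfl⟩ <;>
        simp only [umid, ulow, urev] at h
      · exact hkl rfl
      · exact h4 j (by linear_combination -2 * h)
      · exact h4 j (by linear_combination 2 * h)
      · exact h4 i (by linear_combination 2 * h)
      · exact h2 i j (fun hij => hkl (hij ▸ rfl)) (Or.inl h)
      · by_cases hij : i = j
        · subst hij
          exact h4 i (by linear_combination h)
        · exact h2 i j hij (Or.inr (by linear_combination h))
      · exact h4 i (by linear_combination -2 * h)
      · by_cases hij : i = j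
        · subst hij
          exact h4 i (by linear_combination -h)
        · exact h2 i j hij (Or.inr (by linear_combination -h))
      · exact h2 i j (fun hij => hkl (hij ▸ rfl)) (Or.inl (by linear_combination -h))
    refine ⟨z, ⟨⟨fun i j hij h => ?_, fun i j h => ?_⟩, hz3⟩, funext hlow⟩
    · rw [← hu] at h
      exact key i j hij (by rw [h])
    · rw [← hu, hmid] at h
      -- As `u j = -u j.rev`, a vanishing sum would double to `2u i = 2u j.rev`; for `i = j.rev` it
      -- would say `p = 0`.
      by_cases hij : i = j.rev
      · rw [hij, hanti, neg_add_cancel, zero_add] at h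
        exact ZMod_half_ne_zero hp h
      · refine key i j.rev hij ?_
        rw [hanti]
        linear_combination 2 * h - hpp

end FixedTuples

/-! ### Fixed points of `b k ↦ -b k.rev` on the classes modulo `q`. -/

section Twist

variable {E : Type*} [NormedAddCommGroup E] [InnerProductSpace ℝ E] {n m : ℕ} {c : ℝ}

theorem involution_of_neg_rev {b : OrthonormalBasis (Fin (n + 1)) ℝ E} {w : E ≃ₗᵢ[ℝ] E}
    (hw : ∀ k, w (b k) = -b k.rev) (x : E) : w (w x) = x := by
  have : w * w = 1 := linearIsometryEquiv_ext_basis b fun k => by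
    change w (w (b k)) = b k
    rw [hw, map_neg, hw, neg_neg, Fin.rev_rev]
  exact congrArg (fun v : E ≃ₗᵢ[ℝ] E => v x) this

theorem inner_apply_of_neg_rev {b : OrthonormalBasis (Fin (n + 1)) ℝ E} {w : E ≃ₗᵢ[ℝ] E}
    (hw : ∀ k, w (b k) = -b k.rev) (x y : E) : inner ℝ x (w y) = inner ℝ (w x) y := by
  rw [← w.inner_map_map (w x), involution_of_neg_rev hw]

theorem apply_mem_signedRootsC {b : OrthonormalBasis (Fin (n + 1)) ℝ E} {w : E ≃ₗᵢ[ℝ] E}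
    (hw : ∀ k, w (b k) = -b k.rev) : ∀ β ∈ signedRootsC c b, w β ∈ signedRootsC c b := by
  have hneg : ∀ β ∈ signedRootsC c b, -β ∈ signedRootsC c b := by
    rintro β (h | h)
    · exact Or.inr (by rwa [neg_neg])
    · exact Or.inl h
  refine (forall_signedRootsC (p := fun β => w β ∈ signedRootsC c b) fun β h => ?_).2 ⟨?_, ?_⟩
  · rw [map_neg]
    exact hneg _ h
  · intro i j hij
    rw [map_smul, map_sub, hw, hw, neg_sub_neg]
    exact sub_mem_signedRootsC fun h => hij (Fin.rev_injective h).symm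
  · intro i j
    rw [map_smul, map_add, hw, hw, ← neg_add, smul_neg]
    exact hneg _ (add_mem_signedRootsC _ _)

theorem apply_coordC_mid {b : OrthonormalBasis (Fin (2 * m + 1)) ℝ E} {w : E ≃ₗᵢ[ℝ] E}
    (hw : ∀ k, w (b k) = -b k.rev) (k : Fin (2 * m + 1)) :
    w (coordC c b (midIndex m) k) = -coordC c b (midIndex m) k.rev := by
  by_cases hk : k = midIndex m
  · rw [hk, rev_midIndex, coordC, if_pos rfl, map_smul, map_add, hw, rev_midIndex, ← neg_add,
      smul_neg]
  · have hk' : k.rev ≠ midIndex m := fun h => hk (by rw [← Fin.rev_rev k, h, rev_midIndex])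
    rw [coordC, if_neg hk, coordC, if_neg hk', map_smul, map_sub, hw, hw, rev_midIndex, ← smul_neg]
    congr 1
    abel

/-- Since `w` is a self-adjoint involution and the middle index is its own mirror image, `w` acts on
the coordinates by `z k ↦ -z k.rev`; a class is fixed when this holds modulo `q` for its
coordinates. -/
theorem equivCharQuasi_signedRootsC {b : OrthonormalBasis (Fin (2 * m + 1)) ℝ E} {w : E ≃ₗᵢ[ℝ] E}
    (hc : c ≠ 0) (hw : ∀ k, w (b k) = -b k.rev) (q : ℕ) :
    equivCharQuasi (signedRootsC c b) q w = (fixedTuples m q).ncard := by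
  have hC := isCoordinates_coordC (b := b) hc (midIndex m)
  refine hC.ncard_eq _ _ fun x a ha => ?_
  have hcoord : ∀ (y : E) (a : Fin (2 * m + 1) → ℤ),
      (∀ k, inner ℝ (coordC c b (midIndex m) k) y = a k) →
      ∀ k, inner ℝ (coordC c b (midIndex m) k) (w y) = ((fun k => -a k.rev) k : ℤ) := by
    intro y a ha k
    rw [inner_apply_of_neg_rev hw, apply_coordC_mid hw, inner_neg_left, ha]
    push_cast
    rfl
  refine and_congr (projQ_mem_complementModQ_signedRootsC x a ha) ?_
  constructor
  · rintro ⟨x', y', hy, hx', hy'⟩ k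
    choose a' ha' using hC.integral x' x'.2
    have h1 := (hC.projQ_eq_iff ha' ha).1 hx'
    have h2 := (hC.projQ_eq_iff (x := y') (hy ▸ hcoord x' a' ha') ha).1 hy' k
    have h3 := h1 k.rev
    push_cast at h2
    linear_combination -h2 - h3
  · intro h
    have hwx : w x ∈ coweightLattice (signedRootsC c b) := by
      rw [mem_coweightLattice_signedRootsC hc]
      intro β hβ
      rw [inner_apply_of_neg_rev hw]
      exact x.2.2 _ (apply_mem_signedRootsC hw β hβ)
    refine ⟨x, ⟨w x, hwx⟩, rfl, rfl, (hC.projQ_eq_iff (hcoord x a ha) ha).2 fun k => ?_⟩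
    have h1 : (a k : ZMod q) + a k.rev = 0 := h k
    push_cast
    linear_combination -h1

end Twist

/-! ### Roots of type `BC` and their coweight lattice. -/

section TypeBC

variable {E : Type*} [NormedAddCommGroup E] [InnerProductSpace ℝ E] {m : ℕ}

/-- The roots of type `BC` with short roots `±h i`. -/
def signedRootsBC (h : Fin m → E) : Set E :=
  {y | (∃ i j, i ≠ j ∧ y = h i - h j) ∨ (∃ i j, y = h i + h j ∨ y = -(h i + h j)) ∨
    ∃ i, y = h i ∨ y = -h i}

theorem image_rootsBC (c : ℝ) (φ : EuclideanSpace ℝ (Fin m) →ₗᵢ[ℝ] E) :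
    (fun v => c • φ v) '' rootsBC m = signedRootsBC fun i => c • φ (stdVec i) := by
  ext y
  constructor
  · rintro ⟨v, (⟨i, j, hij, rfl | rfl | rfl | rfl⟩ | ⟨k, rfl | rfl⟩) | ⟨k, rfl | rfl⟩, rfl⟩
    · exact Or.inl ⟨i, j, hij.ne, by simp [smul_sub]⟩
    · exact Or.inl ⟨j, i, hij.ne', by simp [smul_sub]⟩
    · exact Or.inr (Or.inl ⟨i, j, Or.inl (by simp)⟩)
    · exact Or.inr (Or.inl ⟨i, j, Or.inr (by simp [add_comm])⟩)
    · exact Or.inr (Or.inl ⟨k, k, Or.inl (by simp [two_smul])⟩)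
    · exact Or.inr (Or.inl ⟨k, k, Or.inr (by simp [two_smul])⟩)
    · exact Or.inr (Or.inr ⟨k, Or.inl rfl⟩)
    · exact Or.inr (Or.inr ⟨k, Or.inr (by simp)⟩)
  · have key : ∀ i j : Fin m, stdVec i + stdVec j ∈ rootsBC m ∧
        -(stdVec i + stdVec j) ∈ rootsBC m := by
      intro i j
      rcases lt_trichotomy i j with h | rfl | h
      · exact ⟨Or.inl (Or.inl ⟨i, j, h, by simp⟩), Or.inl (Or.inl ⟨i, j, h, by simp⟩)⟩
      · exact ⟨Or.inl (Or.inr ⟨i, Or.inl (two_smul ℝ _).symm⟩),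
          Or.inl (Or.inr ⟨i, Or.inr (by rw [two_smul])⟩)⟩
      · rw [add_comm]
        exact ⟨Or.inl (Or.inl ⟨j, i, h, by simp⟩), Or.inl (Or.inl ⟨j, i, h, by simp⟩)⟩
    rintro (⟨i, j, hij, rfl⟩ | ⟨i, j, rfl | rfl⟩ | ⟨i, rfl | rfl⟩)
    · refine ⟨stdVec i - stdVec j, ?_, by simp [smul_sub]⟩
      rcases lt_or_gt_of_ne hij with h | h
      · exact Or.inl (Or.inl ⟨i, j, h, Or.inl rfl⟩)
      · exact Or.inl (Or.inl ⟨j, i, h, Or.inr (Or.inl (by simp))⟩)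
    · exact ⟨_, (key i j).1, by simp⟩
    · exact ⟨_, (key i j).2, by simp [add_comm]⟩
    · exact ⟨stdVec i, Or.inr ⟨i, Or.inl rfl⟩, rfl⟩
    · exact ⟨-stdVec i, Or.inr ⟨i, Or.inr rfl⟩, by simp⟩

omit [InnerProductSpace ℝ E] in
theorem forall_signedRootsBC {h : Fin m → E} {p : E → Prop} (hp : ∀ β, p β → p (-β)) :
    (∀ β ∈ signedRootsBC h, p β) ↔
      (∀ i j, i ≠ j → p (h i - h j)) ∧ (∀ i j, p (h i + h j)) ∧ ∀ i, p (h i) := by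
  constructor
  · exact fun H => ⟨fun i j hij => H _ (Or.inl ⟨i, j, hij, rfl⟩),
      fun i j => H _ (Or.inr (Or.inl ⟨i, j, Or.inl rfl⟩)),
      fun i => H _ (Or.inr (Or.inr ⟨i, Or.inl rfl⟩))⟩
  · rintro ⟨h1, h2, h3⟩ β (⟨i, j, hij, rfl⟩ | ⟨i, j, rfl | rfl⟩ | ⟨i, rfl | rfl⟩)
    · exact h1 i j hij
    · exact h2 i j
    · exact hp _ (h2 i j)
    · exact h3 i
    · exact hp _ (h3 i)

omit [InnerProductSpace ℝ E] in
theorem short_mem_signedRootsBC (h : Fin m → E) (i : Fin m) : h i ∈ signedRootsBC h :=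
  Or.inr (Or.inr ⟨i, Or.inl rfl⟩)

theorem isCoordinates_signedRootsBC {h : Fin m → E} {d : ℝ} (hd : d ≠ 0)
    (hh : ∀ i j, inner ℝ (h i) (h j) = if i = j then d else 0) :
    IsCoordinates (coweightLattice (signedRootsBC h)) h where
  integral x hx k := hx.2 _ (short_mem_signedRootsBC h k)
  eq_zero x hx h0 := by
    have key : ∀ β ∈ signedRootsBC h, inner ℝ β x = 0 := by
      refine (forall_signedRootsBC (p := fun β => inner ℝ β x = 0) ?_).2 ⟨?_, ?_, h0⟩
      · intro β hβ
        rw [inner_neg_left, hβ, neg_zero]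
      · intro i j _
        rw [inner_sub_left, h0, h0, sub_zero]
      · intro i j
        rw [inner_add_left, h0, h0, add_zero]
    -- The vectors `h i` need not span `E`; `x` vanishes because it lies in the span of the roots
    -- and is orthogonal to it.
    have hspan : ∀ y ∈ Submodule.span ℝ (signedRootsBC h), inner ℝ y x = 0 := by
      intro y hy
      induction hy using Submodule.span_induction with
      | mem y hy => exact key y hy
      | zero => exact inner_zero_left x
      | add y y' _ _ h1 h2 => rw [inner_add_left, h1, h2, add_zero]
      | smul a y _ h1 => rw [inner_smul_left, h1, mul_zero]
    exact inner_self_eq_zero.1 (hspan x hx.1)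
  exists_mem a := by
    let x : E := ∑ k, ((a k : ℝ) / d) • h k
    have hx : ∀ k, inner ℝ (h k) x = a k := fun k => by
      simp [x, inner_sum, inner_smul_right, hh, hd]
    refine ⟨x, ⟨Submodule.sum_mem _ fun k _ => Submodule.smul_mem _ _
      (Submodule.subset_span (short_mem_signedRootsBC h k)), ?_⟩, hx⟩
    refine (forall_signedRootsBC (p := fun β => ∃ n : ℤ, inner ℝ β x = n) ?_).2
      ⟨fun i j _ => ⟨a i - a j, ?_⟩, fun i j => ⟨a i + a j, ?_⟩, fun i => ⟨a i, hx i⟩⟩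
    · rintro β ⟨n, hn⟩
      exact ⟨-n, by simp [hn]⟩
    · rw [inner_sub_left, hx, hx, Int.cast_sub]
    · rw [inner_add_left, hx, hx, Int.cast_add]

/-- In the coordinates given by `h`, the doubled roots require `2u ≠ 0`, `4u ≠ 0` and `2u i ≠ ±2u
j`; the first follows from the second, which leaves the conditions of `foldTuples`. -/
theorem charQuasi_signedRootsBC {h : Fin m → E} {d : ℝ} (hd : d ≠ 0)
    (hh : ∀ i j, inner ℝ (h i) (h j) = if i = j then d else 0) (q : ℕ) :
    charQuasi ((2 : ℝ) • signedRootsBC h) (coweightLattice (signedRootsBC h)) q =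
      (foldTuples m q).ncard := by
  refine (isCoordinates_signedRootsBC hd hh).ncard_eq _ _ fun x a ha => ?_
  rw [projQ_mem_complementModQ]
  · have h1 : (∀ β ∈ (2 : ℝ) • signedRootsBC h, ∀ n : ℤ, inner ℝ β (x : E) = n →
        (n : ZMod q) ≠ 0) ↔ ∀ β ∈ signedRootsBC h, ∀ n : ℤ, inner ℝ β (x : E) = n →
        ((n + n : ℤ) : ZMod q) ≠ 0 := by
      constructor
      · intro H β hβ n hn
        refine H _ (Set.smul_mem_smul_set hβ) _ ?_
        rw [inner_smul_left, hn]
        simp [two_mul]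
      · rintro H _ ⟨β, hβ, rfl⟩ n hn
        obtain ⟨k, hk⟩ := x.2.2 β hβ
        have h2 : n = k + k := by
          change inner ℝ ((2 : ℝ) • β) (x : E) = n at hn
          rw [inner_smul_left, hk] at hn
          have : (n : ℝ) = k + k := by
            rw [← hn]
            simp [two_mul]
          exact_mod_cast this
        rw [h2]
        exact H β hβ k hk
    have h2 : ∀ (β : E) (k : ℤ), inner ℝ β (x : E) = k →
        ((∀ n : ℤ, inner ℝ β (x : E) = n → ((n + n : ℤ) : ZMod q) ≠ 0) ↔
          (k : ZMod q) + k ≠ 0) := by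
      intro β k hk
      constructor
      · intro H
        have := H k hk
        rwa [Int.cast_add] at this
      · intro H n hn
        rw [Int.cast_injective (hn.symm.trans hk), Int.cast_add]
        exact H
    rw [h1, forall_signedRootsBC]
    · have e1 : ∀ i j, inner ℝ (h i - h j) (x : E) = ((a i - a j : ℤ) : ℝ) := fun i j => by
        rw [inner_sub_left, ha, ha, Int.cast_sub]
      have e2 : ∀ i j, inner ℝ (h i + h j) (x : E) = ((a i + a j : ℤ) : ℝ) := fun i j => by
        rw [inner_add_left, ha, ha, Int.cast_add]
      constructor
      · rintro ⟨H1, H2, -⟩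
        refine ⟨fun i hi => ?_, fun i j hij => ?_⟩
        · have := (h2 _ _ (e2 i i)).1 (H2 i i)
          push_cast at this
          exact this hi
        · have H1' := (h2 _ _ (e1 i j)).1 (H1 i j hij)
          have H2' := (h2 _ _ (e2 i j)).1 (H2 i j)
          push_cast at H1' H2'
          rintro (h | h)
          · exact H1' (by linear_combination h)
          · exact H2' (by linear_combination h)
      · rintro ⟨H1, H2⟩
        have H1' : ∀ i, (a i : ZMod q) + a i + (a i + a i) ≠ 0 := H1
        refine ⟨fun i j hij => (h2 _ _ (e1 i j)).2 ?_, fun i j => (h2 _ _ (e2 i j)).2 ?_,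
          fun i => (h2 _ _ (ha i)).2 ?_⟩
        · push_cast
          exact fun h => H2 i j hij (Or.inl (by linear_combination h))
        · push_cast
          by_cases hij : i = j
          · rw [hij]
            exact H1' j
          · exact fun h => H2 i j hij (Or.inr (by linear_combination h))
        · exact fun h => H1' i (by rw [h, add_zero])
    · intro β hβ n hn
      rw [inner_neg_left, neg_eq_iff_eq_neg, ← Int.cast_neg] at hn
      have := hβ _ hn
      rwa [← neg_add, Int.cast_neg, neg_ne_zero] at this
  · rintro y hy _ ⟨β, hβ, rfl⟩
    obtain ⟨k, hk⟩ := hy.2 β hβ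
    refine ⟨2 * k, ?_⟩
    change inner ℝ ((2 : ℝ) • β) y = _
    rw [inner_smul_left, hk]
    simp

end TypeBC

/-! ### The folding by `ω_ℓ` and its type. -/

section Folding

variable {E : Type*} [NormedAddCommGroup E] [InnerProductSpace ℝ E] {m : ℕ} {c : ℝ}
  {b : OrthonormalBasis (Fin (2 * m + 1)) ℝ E} {w : E ≃ₗᵢ[ℝ] E}

theorem average_of_neg_rev (hw : ∀ k, w (b k) = -b k.rev) (x : E) :
    average w x = (2 : ℝ)⁻¹ • (x + w x) := by
  -- The involution is not the identity because it negates the middle basis vector.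
  have hord : orderOf w = 2 := by
    refine orderOf_eq_prime ?_ fun h => ?_
    · ext x
      rw [pow_two]
      exact involution_of_neg_rev hw x
    · have h1 := hw (midIndex m)
      rw [h, rev_midIndex] at h1
      have h2 : (2 : ℝ) • b (midIndex m) = 0 := by
        rw [two_smul]
        exact eq_neg_iff_add_eq_zero.1 h1
      exact b.orthonormal.ne_zero (midIndex m) ((smul_eq_zero.1 h2).resolve_left two_ne_zero)
  rw [average, hord, show Finset.Icc 1 2 = {1, 2} from rfl, Finset.sum_pair (by norm_num), pow_one,
    pow_two]
  change ((2 : ℕ) : ℝ)⁻¹ • (w x + w (w x)) = _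
  rw [involution_of_neg_rev hw, add_comm, Nat.cast_ofNat]

/-- The short roots of the folding. -/
noncomputable def foldedVec (c : ℝ) (b : OrthonormalBasis (Fin (2 * m + 1)) ℝ E) (i : Fin m) : E :=
  (c / 2) • (b (lowIndex i) - b (lowIndex i).rev)

theorem inner_foldedVec (i j : Fin m) :
    inner ℝ (foldedVec c b i) (foldedVec c b j) = if i = j then c ^ 2 / 2 else 0 := by
  simp only [foldedVec, inner_smul_left, inner_smul_right, inner_sub_left, inner_sub_right,
    b.inner_eq_ite, lowIndex_ne_rev, (lowIndex_ne_rev _ _).symm, lowIndex_injective.eq_iff,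
    Fin.rev_inj, conj_trivial, if_false]
  split_ifs <;> ring

theorem average_smul_basis (hw : ∀ k, w (b k) = -b k.rev) (k : Fin (2 * m + 1)) :
    average w (c • b k) = (c / 2) • (b k - b k.rev) := by
  rw [average_of_neg_rev hw, map_smul, hw, smul_neg, ← sub_eq_add_neg, ← smul_sub, smul_smul]
  congr 1
  ring

theorem average_mid (hw : ∀ k, w (b k) = -b k.rev) : average w (c • b (midIndex m)) = 0 := by
  rw [average_smul_basis hw, rev_midIndex, sub_self, smul_zero]

theorem average_low (hw : ∀ k, w (b k) = -b k.rev) (i : Fin m) :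
    average w (c • b (lowIndex i)) = foldedVec c b i :=
  average_smul_basis hw _

theorem average_rev_low (hw : ∀ k, w (b k) = -b k.rev) (i : Fin m) :
    average w (c • b (lowIndex i).rev) = -foldedVec c b i := by
  rw [average_smul_basis hw, Fin.rev_rev, foldedVec, ← smul_neg, neg_sub]

theorem average_add (hw : ∀ k, w (b k) = -b k.rev) (x y : E) :
    average w (x + y) = average w x + average w y := by
  simp only [average_of_neg_rev hw, map_add, ← smul_add]
  congr 1
  abel

theorem average_neg (hw : ∀ k, w (b k) = -b k.rev) (x : E) :
    average w (-x) = -average w x := by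
  simp only [average_of_neg_rev hw, map_neg, ← neg_add, smul_neg]

omit [InnerProductSpace ℝ E] in
theorem add_mem_signedRootsBC {h : Fin m → E} {x y : E}
    (hx : x = 0 ∨ ∃ i, x = h i ∨ x = -h i) (hy : y = 0 ∨ ∃ i, y = h i ∨ y = -h i)
    (hxy : x + y ≠ 0) : x + y ∈ signedRootsBC h := by
  rcases hx with rfl | ⟨i, rfl | rfl⟩ <;> rcases hy with rfl | ⟨j, rfl | rfl⟩
  · exact absurd (add_zero 0) hxy
  · exact Or.inr (Or.inr ⟨j, Or.inl (zero_add _)⟩)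
  · exact Or.inr (Or.inr ⟨j, Or.inr (zero_add _)⟩)
  · exact Or.inr (Or.inr ⟨i, Or.inl (add_zero _)⟩)
  · exact Or.inr (Or.inl ⟨i, j, Or.inl rfl⟩)
  · refine Or.inl ⟨i, j, ?_, (sub_eq_add_neg _ _).symm⟩
    rintro rfl
    exact hxy (add_neg_cancel _)
  · exact Or.inr (Or.inr ⟨i, Or.inr (add_zero _)⟩)
  · refine Or.inl ⟨j, i, ?_, by abel⟩
    rintro rfl
    exact hxy (neg_add_cancel _)
  · exact Or.inr (Or.inl ⟨i, j, Or.inr (neg_add _ _).symm⟩)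

/-- Averaging sends the vectors `c b k` to `0` (the middle one) and to `±foldedVec c b i`. Nonzero
sums and differences of these are the `BC` roots, the short ones arising from pairs that involve the
middle index. -/
theorem folding_signedRootsC (hc : 0 < c) (hw : ∀ k, w (b k) = -b k.rev) :
    folding (signedRootsC c b) w = signedRootsBC (foldedVec c b) := by
  have hc2 : 0 < c ^ 2 / 2 := by positivity
  have hcases : ∀ k, average w (c • b k) = 0 ∨
      ∃ i, average w (c • b k) = foldedVec c b i ∨ average w (c • b k) = -foldedVec c b i := by
    intro k
    rcases index_cases k with rfl | ⟨i, rfl | rfl⟩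
    · exact Or.inl (average_mid hw)
    · exact Or.inr ⟨i, Or.inl (average_low hw i)⟩
    · exact Or.inr ⟨i, Or.inr (average_rev_low hw i)⟩
  have hneg : ∀ y ∈ signedRootsBC (foldedVec c b), -y ∈ signedRootsBC (foldedVec c b) := by
    rintro y (⟨i, j, hij, rfl⟩ | ⟨i, j, rfl | rfl⟩ | ⟨i, rfl | rfl⟩)
    · exact Or.inl ⟨j, i, hij.symm, neg_sub _ _⟩
    · exact Or.inr (Or.inl ⟨i, j, Or.inr rfl⟩)
    · exact Or.inr (Or.inl ⟨i, j, Or.inl (neg_neg _)⟩)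
    · exact Or.inr (Or.inr ⟨i, Or.inr rfl⟩)
    · exact Or.inr (Or.inr ⟨i, Or.inl (neg_neg _)⟩)
  have hnegF : ∀ y ∈ folding (signedRootsC c b) w, -y ∈ folding (signedRootsC c b) w := by
    rintro y ⟨hy, β, hβ, rfl⟩
    refine ⟨neg_ne_zero.2 hy, -β, ?_, average_neg hw β⟩
    rcases hβ with hβ | hβ
    · exact Or.inr (by rwa [neg_neg])
    · exact Or.inl hβ
  refine Set.Subset.antisymm ?_ ?_
  · have key : ∀ β ∈ signedRootsC c b, average w β ≠ 0 →
        average w β ∈ signedRootsBC (foldedVec c b) := by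
      refine (forall_signedRootsC (p := fun β => average w β ≠ 0 →
        average w β ∈ signedRootsBC (foldedVec c b)) fun β h hβ => ?_).2
        ⟨fun i j _ h => ?_, fun i j h => ?_⟩
      · rw [average_neg hw] at hβ ⊢
        exact hneg _ (h (neg_ne_zero.1 hβ))
      · rw [smul_sub, sub_eq_add_neg, average_add hw, average_neg hw] at h ⊢
        refine add_mem_signedRootsBC (hcases i) ?_ h
        rcases hcases j with h | ⟨k, h | h⟩
        · exact Or.inl (by rw [h, neg_zero])
        · exact Or.inr ⟨k, Or.inr (by rw [h])⟩
        · exact Or.inr ⟨k, Or.inl (by rw [h, neg_neg])⟩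
      · rw [smul_add, average_add hw] at h ⊢
        exact add_mem_signedRootsBC (hcases i) (hcases j) h
    rintro y ⟨hy, β, hβ, rfl⟩
    exact key β hβ hy
  · refine (forall_signedRootsBC (p := fun y => y ∈ folding (signedRootsC c b) w) hnegF).2
      ⟨fun i j hij => ⟨fun h => ?_, _,
        sub_mem_signedRootsC (c := c) (b := b) (lowIndex_injective.ne hij), ?_⟩,
      fun i j => ⟨fun h => ?_, _,
        add_mem_signedRootsC (c := c) (b := b) (lowIndex i) (lowIndex j), ?_⟩,
      fun i => ⟨fun h => ?_, _,
        add_mem_signedRootsC (c := c) (b := b) (lowIndex i) (midIndex m), ?_⟩⟩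
    · have h1 : inner ℝ (foldedVec c b i) (foldedVec c b i - foldedVec c b j) = 0 := by
        rw [h, inner_zero_right]
      rw [inner_sub_right, inner_foldedVec, inner_foldedVec, if_pos rfl, if_neg hij] at h1
      linarith
    · rw [smul_sub, sub_eq_add_neg, average_add hw, average_neg hw, average_low hw, average_low hw,
        sub_eq_add_neg]
    · have h1 : inner ℝ (foldedVec c b i) (foldedVec c b i + foldedVec c b j) = 0 := by
        rw [h, inner_zero_right]
      rw [inner_add_right, inner_foldedVec, inner_foldedVec, if_pos rfl] at h1
      split_ifs at h1 <;> linarith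
    · rw [smul_add, average_add hw, average_low hw, average_low hw]
    · have h1 : inner ℝ (foldedVec c b i) (foldedVec c b i) = 0 := by
        rw [h, inner_zero_right]
      rw [inner_foldedVec, if_pos rfl] at h1
      linarith
    · rw [smul_add, average_add hw, average_low hw, average_mid hw, add_zero]

/-- The short roots are orthogonal of squared length `c ^ 2 / 2`, so the similarity factor is `c /
√2`. -/
theorem isTypeBC_signedRootsBC (hc : 0 < c) : IsTypeBC m (signedRootsBC (foldedVec c b)) := by
  have hs : (0 : ℝ) < √2 := Real.sqrt_pos.2 two_pos
  have hd : 0 < c / √2 := div_pos hc hs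
  let e := (EuclideanSpace.basisFun (Fin m) ℝ).toBasis
  have he : ∀ i, e i = stdVec i := fun i => by simp [e, stdVec]
  let f : EuclideanSpace ℝ (Fin m) →ₗ[ℝ] E := e.constr ℝ fun i => (c / √2)⁻¹ • foldedVec c b i
  have hf : ∀ i, f (e i) = (c / √2)⁻¹ • foldedVec c b i := fun i => e.constr_basis ℝ _ i
  have horth : Orthonormal ℝ (f ∘ e) := by
    rw [orthonormal_iff_ite]
    intro i j
    simp only [Function.comp_apply, hf, inner_smul_left, inner_smul_right, inner_foldedVec,
      conj_trivial]
    split_ifs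
    · field_simp
      exact Real.sq_sqrt zero_le_two
    · ring
  have horth' : Orthonormal ℝ e := by
    simp [e]
  refine ⟨c / √2, f.isometryOfOrthonormal horth' horth, hd, ?_⟩
  rw [image_rootsBC]
  congr 1
  funext i
  rw [← he]
  change _ = (c / √2) • f (e i)
  rw [hf, smul_smul, mul_inv_cancel₀ hd.ne', one_smul]

end Folding

end RootChar

open RootChar
theorem mainTheorem7 {E : Type*} [NormedAddCommGroup E] [InnerProductSpace ℝ E]
    (l : ℕ) (hl : Odd l) (Φ : Set E) (α : Fin l → E) (hΦ : IsTypeC l Φ α)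
    (j : Fin l) (hj : (j : ℕ) + 1 = l) :
    -- the value at the identity
    (∀ q : ℕ, 0 < q →
      equivCharQuasi Φ q 1 = charQuasi Φ (coweightLattice Φ) q ∧
      (Odd q → (equivCharQuasi Φ q 1 : ℤ) =
        ∏ i ∈ Finset.Icc 1 l, ((q : ℤ) - (2 * (i : ℤ) - 1))) ∧
      (Even q → (equivCharQuasi Φ q 1 : ℤ) =
        (∏ i ∈ Finset.Icc 1 (l - 1), ((q : ℤ) - 2 * (i : ℤ))) * ((q : ℤ) - (l : ℤ)))) ∧
    -- the value at `ω_ℓ`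
    (∀ q : ℕ, 0 < q →
      (Nat.gcd 4 q = 1 → equivCharQuasi Φ q (omega α j) = 0) ∧
      (Nat.gcd 4 q = 2 → (equivCharQuasi Φ q (omega α j) : ℤ) =
        ∏ i ∈ Finset.Icc 1 ((l - 1) / 2), ((q : ℤ) - 2 * (2 * (i : ℤ) - 1))) ∧
      (Nat.gcd 4 q = 4 → (equivCharQuasi Φ q (omega α j) : ℤ) =
        ∏ i ∈ Finset.Icc 1 ((l - 1) / 2), ((q : ℤ) - 4 * (i : ℤ)))) ∧
    -- the folding by `ω_ℓ` is of type `BC`, and its dilation by `2` gives the value at `ω_ℓ`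
    (IsTypeBC ((l - 1) / 2) (folding Φ (omega α j)) ∧
      ∀ q : ℕ, 0 < q → Even q →
        equivCharQuasi Φ q (omega α j) =
          charQuasi ((2 : ℝ) • folding Φ (omega α j))
            (coweightLattice (folding Φ (omega α j))) q) := by
  obtain ⟨m, rfl⟩ := hl
  obtain ⟨c, b, hs, hΦ'⟩ := hΦ.exists_basis
  replace hΦ' : Φ = signedRootsC c b := hΦ'
  subst hΦ'
  have hj' : j = Fin.last (2 * m) := Fin.ext (by simpa using hj)
  subst hj'
  have hc : c ≠ 0 := hs.pos.ne'
  have hw := hs.omega_apply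
  have hm : (2 * m + 1 - 1) / 2 = m := by omega
  -- At the identity any reference index would serve; the middle one is needed only for `ω_ℓ`.
  have hone : ∀ q, equivCharQuasi (signedRootsC c b) q 1 =
      (regularTuples (midIndex m) q).ncard := fun q => by
    rw [equivCharQuasi_one, charQuasi_signedRootsC hc (midIndex m)]
  have homega := equivCharQuasi_signedRootsC hc hw
  rw [hm]
  refine ⟨fun q hq => ⟨equivCharQuasi_one _ q, fun hodd => ?_, fun heven => ?_⟩,
    fun q hq => ⟨fun hg => ?_, fun hg => ?_, fun hg => ?_⟩, ?_, fun q hq heven => ?_⟩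
  · rw [hone, ncard_regularTuples_odd _ hodd]
  · rw [hone, ncard_regularTuples_even _ hq heven, Nat.add_sub_cancel]
  · have hodd : Odd q := by
      rw [← Nat.not_even_iff_odd, even_iff_two_dvd]
      intro h
      have := Nat.dvd_gcd (show 2 ∣ 4 by norm_num) h
      omega
    rw [homega, fixedTuples_odd hodd, Set.ncard_empty]
  · obtain ⟨p, rfl⟩ : 2 ∣ q := hg ▸ Nat.gcd_dvd_right 4 q
    have hp : Odd p := by
      rw [← Nat.not_even_iff_odd, even_iff_two_dvd]
      rintro ⟨s, rfl⟩
      have := Nat.dvd_gcd (dvd_refl 4) (show 4 ∣ 2 * (2 * s) from ⟨s, by ring⟩)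
      omega
    rw [homega, ncard_fixedTuples hp.pos, ncard_foldTuples_odd hp]
  · obtain ⟨s, rfl⟩ : 4 ∣ q := hg ▸ Nat.gcd_dvd_right 4 q
    have hs' : 4 * s = 2 * (2 * s) := by ring
    rw [homega, hs', ncard_fixedTuples (by omega),
      ncard_foldTuples_even (by omega) (even_two_mul s)]
  · rw [folding_signedRootsC hs.pos hw]
    exact isTypeBC_signedRootsBC hs.pos
  · obtain ⟨p, rfl⟩ := even_iff_two_dvd.1 heven
    have hd : c ^ 2 / 2 ≠ 0 := by positivity
    rw [homega, folding_signedRootsC hs.pos hw, charQuasi_signedRootsBC hd inner_foldedVec,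
      ncard_fixedTuples (by omega)]
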